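/- Let $G$ be the directed graph on $V=\mathbb Z$ with vertex measure $m\equiv 1$ and edge weights $b(l,l+1)=\frac{|l|^3+1}{2}+\frac14$, $b(l+1,l)=\frac{|l|^3+1}{2}-\frac14$ for $l\in\mathbb Z$, and $b(x,y)=0$ for all other pairs; $(x,y)$ is an edge iff $b(x,y)>0$. Put $V_n=\{-n,\dots,n\}$ and $V_n^c=\mathbb Z\setminus V_n$ for $n\in\mathbb N$. Notation. $\mathcal C_c(X)$ denotes the finitely supported complex functions on $X$, and $\beta^+(x)=\sum_y b(x,y)$, $\beta^-(x)=\sum_y b(y,x)$. For $\Omega\subset\mathbb Z$, $$\tilde h(\Omega)=\inf\Big\{\frac{\sum_{e\in\partial_E U}b(e)}{\sum_{x\in U}\beta^+(x)}:\ \emptyset\ne U\subset\Omega \text{ finite}\Big\},$$ where $\partial_E U$ is the set of directed edges with exactly one endpoint in $U$, and $\tilde h_\infty=\lim_{n\to\infty}\tilde h(V_n^c)$. On the domain $\mathcal C_c(\mathbb Z)$ in $\ell^2(\mathbb Z)$ let $\Delta f(x)=\sum_y b(x,y)(f(x)-f(y))$, $\Delta' f(x)=\sum_y b(y,x)(f(x)-f(y))$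 and $H=\frac12(\Delta+\Delta')$; let $\overline\Delta$ be the closure and $\Delta^*$ the adjoint of $\Delta$, and $S=\frac12(\overline\Delta+\Delta^*)$ on $D(\overline\Delta)\cap D(\Delta^*)$. For $\Omega\subset\mathbb Z$ let $H^D_\Omega$ be the Dirichlet operator in $\ell^2(\Omega)$ with domain $\mathcal C_c(\Omega)$ (extend $f$ by zero, apply $H$, restrict to $\Omega$) and $S^D_\Omega$ its closure; $\lambda_1$ denotes the bottom of the spectrum. The essential spectrum $\sigma_{ess}(A)$ of a closed operator $A$ is the set of $\lambda\in\mathbb C$ such that the range of $A-\lambda$ is not closed or $\dim\ker(A-\lambda)=\infty$. Then: 1. $\beta^+=\beta^-$ on $\mathbb Z$, and $\sup_x\sum_y|b(x,y)-b(y,x)|<\infty$; $\Delta$ is closable, $H$ is essentially self-adjoint, $S=\overline H$ and $D(S)=D(\overline\Delta)$. 2. $\tilde h_\infty=0$. 3. (Hardy inequality) For every finitely supported $f:\mathbb Z\to\mathbb C$, $$\frac14\sum_{k\in\mathbb Z}|f(k)|^2\le\sum_{k\in\mathbb Z}k^2|f(k-1)-f(k)|^2.$$ 4. For every $n\in\mathbb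 N$ the operator $H^D_{V_n^c}$ is essentially self-adjoint, and $$\lambda_1(S^D_{V_n^c})=\inf_{f\in\mathcal C_c(V_n^c),\ \|f\|=1}(H^D_{V_n^c}f,f)\ \ge\ \frac n8 ;$$ in particular $\lambda_1(S^D_{V_n^c})\to\infty$ as $n\to\infty$. 5. $\sigma_{ess}(S)=\emptyset$ and $\sigma_{ess}(\overline\Delta)=\emptyset$. -/

import Mathlib

open Filter Topology

noncomputable section

/-- A locally finite directed graph without loops on the vertex set `V`, given by its nonnegative,
not necessarily symmetric, edge weights; `(x, y)` is a directed edge iff `0 < b x y`.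
The measure on the vertices is `m = 1` throughout, so that `ℓ²(V, m) = ℓ²(V)`. -/
structure WeightedDigraph (V : Type*) where
  b : V → V → ℝ
  nonneg : ∀ x y, 0 ≤ b x y
  loopless : ∀ x, b x x = 0
  finite_out : ∀ x, {y | 0 < b x y}.Finite
  finite_in : ∀ y, {x | 0 < b x y}.Finite

/-- The Hilbert space `ℓ²(X)` of square summable complex functions. -/
abbrev EllTwo (X : Type*) := lp (fun _ : X => ℂ) 2

/-- The space `C_c(X)` of finitely supported functions, as a subspace of `ℓ²(X)`. -/
def finSupp (X : Type*) : Submodule ℂ (EllTwo X) where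
  carrier := {f | (Function.support (f : X → ℂ)).Finite}
  zero_mem' := by
    change (Function.support (0 : X → ℂ)).Finite
    simp
  add_mem' := by
    intro f g hf hg
    exact (hf.union hg).subset (Function.support_add (f : X → ℂ) (g : X → ℂ))
  smul_mem' := by
    intro c f hf
    exact Set.Finite.subset hf (Function.support_const_smul_subset c (f : X → ℂ))

lemma memlp_of_finite_support {X : Type*} {f : X → ℂ} (hf : (Function.support f).Finite) :
    Memℓp (E := fun _ : X => ℂ) f 2 :=
  Memℓp.of_exponent_ge (memℓp_zero hf) zero_le

/-- Extension by zero of a function on `Ω` to a function on `V`. -/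
def extendZero {V : Type*} (Ω : Set V) (f : Ω → ℂ) : V → ℂ := Function.extend Subtype.val f (0 : V → ℂ)

lemma extendZero_support {V : Type*} (Ω : Set V) {f : Ω → ℂ} (hf : (Function.support f).Finite) :
    (Function.support (extendZero Ω f)).Finite := by
  refine (hf.image Subtype.val).subset ?_
  intro x hx
  by_cases h : ∃ a : Ω, a.1 = x
  · obtain ⟨a, rfl⟩ := h
    refine ⟨a, ?_, rfl⟩
    simpa [extendZero, Subtype.val_injective.extend_apply] using hx
  · exact absurd (Function.extend_apply' f (0 : V → ℂ) x h) hx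

/-- The unbounded operator on `ℓ²(V)` with domain `C_c(V)` given by the formal operator `L`. -/
def opOnFinSupp {V : Type*} (L : (V → ℂ) →ₗ[ℂ] (V → ℂ))
    (hL : ∀ f, (Function.support f).Finite → (Function.support (L f)).Finite) :
    EllTwo V →ₗ.[ℂ] EllTwo V where
  domain := finSupp V
  toFun :=
    { toFun := fun f => ⟨L (f : EllTwo V), memlp_of_finite_support (hL _ f.2)⟩
      map_add' := fun f g => by
        ext x
        exact congrFun (L.map_add (f : EllTwo V) (g : EllTwo V)) x
      map_smul' := fun c f => by
        ext x
        exact congrFun (L.map_smul c ((f : EllTwo V) : V → ℂ)) x }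

/-- The Dirichlet operator on `ℓ²(Ω)` with domain `C_c(Ω)` given by the formal operator `L`:
extend `f ∈ C_c(Ω)` by zero to `V`, apply `L`, and restrict to `Ω`. -/
def dirichletOp {V : Type*} (L : (V → ℂ) →ₗ[ℂ] (V → ℂ))
    (hL : ∀ f, (Function.support f).Finite → (Function.support (L f)).Finite) (Ω : Set V) :
    EllTwo Ω →ₗ.[ℂ] EllTwo Ω where
  domain := finSupp Ω
  toFun :=
    { toFun := fun f => ⟨fun x => L (extendZero Ω (f : EllTwo Ω)) x,
        memlp_of_finite_support
          ((hL _ (extendZero_support Ω f.2)).preimage Subtype.val_injective.injOn)⟩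
      map_add' := fun f g => by
        have h : extendZero Ω ((f : EllTwo Ω) + (g : EllTwo Ω) : Ω → ℂ)
            = extendZero Ω (f : EllTwo Ω) + extendZero Ω (g : EllTwo Ω) := by
          have := Function.extend_add (Subtype.val : Ω → V)
            ((f : EllTwo Ω) : Ω → ℂ) ((g : EllTwo Ω) : Ω → ℂ) 0 0
          simpa [extendZero] using this
        ext x
        refine (congrFun (congrArg L h) x).trans ?_
        rw [map_add]
        rfl
      map_smul' := fun c f => by
        have h : extendZero Ω (c • ((f : EllTwo Ω) : Ω → ℂ))
            = c • extendZero Ω (f : EllTwo Ω) := by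
          have := Function.extend_smul c (Subtype.val : Ω → V) ((f : EllTwo Ω) : Ω → ℂ) 0
          simpa [extendZero] using this
        ext x
        refine (congrFun (congrArg L h) x).trans ?_
        rw [map_smul]
        rfl }

namespace WeightedDigraph

variable {V : Type*} (G : WeightedDigraph V)

/-- The graph with all edges reversed. -/
def reverse : WeightedDigraph V where
  b x y := G.b y x
  nonneg x y := G.nonneg y x
  loopless := G.loopless
  finite_out := G.finite_in
  finite_in := G.finite_out

/-- `β⁺(x) = ∑_y b(x,y)`. -/
def outWeight (x : V) : ℝ := ∑' y, G.b x y

/-- `β⁻(x) = ∑_y b(y,x)`. -/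
def inWeight (x : V) : ℝ := ∑' y, G.b y x

/-- Assumption `(β)` (Kirchhoff's law). -/
def AssumptionBeta : Prop := ∀ x, G.outWeight x = G.inWeight x

/-- Assumption `(γ)`, for the vertex measure `m = 1`. -/
def AssumptionGamma : Prop := ∃ M : ℝ, 0 < M ∧ ∀ x, ∑' y, |G.b x y - G.b y x| ≤ M

/-- The set `∂_E U` of the directed edges leaving or entering `U`. -/
def edgeBoundary (U : Set V) : Set (V × V) :=
  {e | 0 < G.b e.1 e.2 ∧ ((e.1 ∈ U ∧ e.2 ∉ U) ∨ (e.1 ∉ U ∧ e.2 ∈ U))}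

/-- The Cheeger constant `h̃(Ω)`: infimum over the nonempty finite `U ⊆ Ω` of
`b(∂_E U) / β⁺(U)`. -/
def cheegerTilde (Ω : Set V) : ℝ :=
  sInf {r | ∃ U : Finset V, U.Nonempty ∧ (U : Set V) ⊆ Ω ∧
    r = (∑' e : G.edgeBoundary U, G.b e.1.1 e.1.2) / ∑ x ∈ U, G.outWeight x}

lemma summable_lap (f : V → ℂ) (x : V) :
    Summable fun y => (G.b x y : ℂ) * (f x - f y) := by
  refine summable_of_hasFiniteSupport ((G.finite_out x).subset fun y hy => ?_)
  refine lt_of_le_of_ne (G.nonneg x y) fun h => hy ?_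
  simp [← h]

/-- The formal Laplacian `Δf(x) = ∑_y b(x,y) (f(x) - f(y))`. -/
def lap : (V → ℂ) →ₗ[ℂ] (V → ℂ) where
  toFun f x := ∑' y, (G.b x y : ℂ) * (f x - f y)
  map_add' f g := by
    ext x
    refine Eq.trans ?_ ((G.summable_lap f x).tsum_add (G.summable_lap g x))
    exact tsum_congr fun y => by simp only [Pi.add_apply]; ring
  map_smul' c f := by
    ext x
    simp only [Pi.smul_apply, smul_eq_mul, RingHom.id_apply]
    rw [← tsum_mul_left]
    exact tsum_congr fun y => by ring

lemma lap_finite (f : V → ℂ) (hf : (Function.support f).Finite) :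
    (Function.support (G.lap f)).Finite := by
  refine (hf.union (hf.biUnion fun y _ => G.finite_in y)).subset fun x hx => ?_
  by_contra hcon
  simp only [Set.mem_union, Function.mem_support, Set.mem_iUnion, Set.mem_ofPred_eq, not_or,
    not_not, not_exists, not_lt] at hcon
  refine hx ?_
  change ∑' y, (G.b x y : ℂ) * (f x - f y) = 0
  rw [← tsum_zero (α := ℂ) (β := V)]
  refine tsum_congr fun y => ?_
  by_cases hy : f y = 0
  · simp [hcon.1, hy]
  · have : G.b x y = 0 := le_antisymm (hcon.2 y hy) (G.nonneg x y)
    simp [this]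

/-- The formal expression of `H = (Δ + Δ')/2`, where `Δ'f(x) = ∑_y b(y,x) (f(x) - f(y))`. -/
def symLap : (V → ℂ) →ₗ[ℂ] (V → ℂ) := (1 / 2 : ℂ) • (G.lap + G.reverse.lap)

lemma symLap_finite (f : V → ℂ) (hf : (Function.support f).Finite) :
    (Function.support (G.symLap f)).Finite := by
  refine ((G.lap_finite f hf).union (G.reverse.lap_finite f hf)).subset fun x hx => ?_
  by_contra hcon
  simp only [Set.mem_union, Function.mem_support, not_or, not_not] at hcon
  exact hx (by simp [symLap, hcon.1, hcon.2])

/-- The Laplacian `Δ` in `ℓ²(V)` with domain `C_c(V)`. -/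
def Delta : EllTwo V →ₗ.[ℂ] EllTwo V := opOnFinSupp G.lap G.lap_finite

/-- The operator `H = (Δ + Δ')/2` in `ℓ²(V)` with domain `C_c(V)`. -/
def H : EllTwo V →ₗ.[ℂ] EllTwo V := opOnFinSupp G.symLap G.symLap_finite

/-- The operator `S = (Δ̄ + Δ*)/2` with domain `D(Δ̄) ∩ D(Δ*)`. -/
def S : EllTwo V →ₗ.[ℂ] EllTwo V :=
  (1 / 2 : ℂ) • (G.Delta.closure + LinearPMap.adjoint G.Delta)

/-- The Dirichlet operator `H^D_Ω` in `ℓ²(Ω)` with domain `C_c(Ω)`. -/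
def HDirichlet (Ω : Set V) : EllTwo Ω →ₗ.[ℂ] EllTwo Ω := dirichletOp G.symLap G.symLap_finite Ω

/-- The Dirichlet operator `S^D_Ω`, the closure of `H^D_Ω`. -/
def SDirichlet (Ω : Set V) : EllTwo Ω →ₗ.[ℂ] EllTwo Ω := (G.HDirichlet Ω).closure

end WeightedDigraph

/-- `A` is essentially self-adjoint: it is closable and its closure is self-adjoint. -/
def EssentiallySelfAdjoint {E : Type*} [NormedAddCommGroup E] [InnerProductSpace ℂ E]
    [CompleteSpace E] (A : E →ₗ.[ℂ] E) : Prop :=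
  A.IsClosable ∧ IsSelfAdjoint A.closure

/-- The linear map `A - z` on the domain of `A`. -/
def subScalar {E : Type*} [NormedAddCommGroup E] [InnerProductSpace ℂ E]
    (A : E →ₗ.[ℂ] E) (z : ℂ) : A.domain →ₗ[ℂ] E := A.toFun - z • A.domain.subtype

/-- The essential spectrum: all `z` such that the range of `A - z` is not closed or the kernel of
`A - z` has infinite dimension. -/
def essSpectrum {E : Type*} [NormedAddCommGroup E] [InnerProductSpace ℂ E]
    (A : E →ₗ.[ℂ] E) : Set ℂ :=
  {z | ¬ IsClosed (LinearMap.range (subScalar A z) : Set E) ∨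
    ¬ FiniteDimensional ℂ (LinearMap.ker (subScalar A z))}

/-- The spectrum: all `z` such that `A - z : D(A) → E` does not have an everywhere defined bounded
two-sided inverse. -/
def pmapSpectrum {E : Type*} [NormedAddCommGroup E] [InnerProductSpace ℂ E]
    (A : E →ₗ.[ℂ] E) : Set ℂ :=
  {z | ¬ ∃ R : E →L[ℂ] E, (∀ u : A.domain, R (subScalar A z u) = u) ∧
    ∀ v : E, ∃ h : R v ∈ A.domain, subScalar A z ⟨R v, h⟩ = v}

/-- The bottom `λ₁(A)` of the spectrum of a self-adjoint operator `A`. -/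
def lambdaOne {E : Type*} [NormedAddCommGroup E] [InnerProductSpace ℂ E]
    (A : E →ₗ.[ℂ] E) : ℝ :=
  sInf {t : ℝ | (t : ℂ) ∈ pmapSpectrum A}

/-- The infimum of the Rayleigh quotient `(A f, f)` over the unit vectors `f ∈ D(A)`, for a
symmetric operator `A`. -/
def rayleighInf {E : Type*} [NormedAddCommGroup E] [InnerProductSpace ℂ E]
    (A : E →ₗ.[ℂ] E) : ℝ :=
  sInf {t : ℝ | ∃ f : A.domain, ‖(f : E)‖ = 1 ∧ t = (inner ℂ (f : E) (A f)).re}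

/-- The weights on `ℤ`: `b(l,l+1) = (|l|³+1)/2 + 1/4`, `b(l+1,l) = (|l|³+1)/2 - 1/4`, and zero for
all other pairs. -/
def cubicWeight (x y : ℤ) : ℝ :=
  if y = x + 1 then (|(x : ℝ)| ^ 3 + 1) / 2 + 1 / 4
  else if x = y + 1 then (|(y : ℝ)| ^ 3 + 1) / 2 - 1 / 4
  else 0

/-- The weighted directed graph on `ℤ` with the weights `cubicWeight`. -/
def cubicGraph : WeightedDigraph ℤ where
  b := cubicWeight
  nonneg x y := by
    unfold cubicWeight
    split_ifs
    · positivity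
    · have : 0 ≤ |(y : ℝ)| ^ 3 := by positivity
      linarith
    · exact le_rfl
  loopless x := by simp [cubicWeight]
  finite_out x := by
    refine (Set.toFinite {x + 1, x - 1}).subset fun y hy => ?_
    by_contra h
    simp only [Set.mem_insert_iff, Set.mem_singleton_iff, not_or] at h
    have h2 : x ≠ y + 1 := by omega
    simp [cubicWeight, h.1, h2] at hy
  finite_in y := by
    refine (Set.toFinite {y + 1, y - 1}).subset fun x hx => ?_
    by_contra h
    simp only [Set.mem_insert_iff, Set.mem_singleton_iff, not_or] at h
    have h2 : y ≠ x + 1 := by omega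
    simp [cubicWeight, h.1, h2] at hx

/-- The vertex set `V_n = {-n, …, n}` of the filtration of `ℤ`. -/
def ballZ (n : ℕ) : Set ℤ := Set.Icc (-(n : ℤ)) n

end

noncomputable section

/-! ### Closed, symmetric and perturbed unbounded operators on a Hilbert space. -/

section Operators

variable {E : Type*} [NormedAddCommGroup E] [InnerProductSpace ℂ E]

/-! The edge weights differ from their symmetric part by the constant ±1/4, so `Delta` is `H` plus
`skewPart`, a quarter of a difference of two shifts, which is bounded and skew-adjoint. Bounded
perturbations commute with closures, and once `H` is essentially self-adjoint the closure of Δ is H̄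
+ K and its adjoint is H̄ - K; averaging gives S = H̄ with the same domain
(`closure_of_perturbation`, `half_closure_add_adjoint`).

Essential self-adjointness of `H` and of all its Dirichlet restrictions is a maximum principle. A
vector orthogonal to the range of A + 1 solves Hv = -v on the vertex set and tends to zero at
infinity, so |v| attains its maximum, and the equation fails there unless v = 0
(`eq_zero_of_symLap_eq_neg`).

The spectral statements rest on one weighted Hardy inequality: weights growing like |k|³/2 force the
form of `H` to dominate the sum of (3|k|/8 - 1/4)|u(k)|² (`tsum_weight_le_form`). Outside V_n this
weight is at least n/8, which bounds the Rayleigh quotient and hence λ₁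
(`lambdaOne_closure_eq_rayleighInf`). On all of ℤ it bounds the first moment of |u|² by the graph
norm, so the domain of H̄, and with it that of the closure of Δ, embeds compactly in ℓ². For a
closed operator this makes kernels finite-dimensional and ranges closed
(`essSpectrum_eq_empty_of_compact`); self-adjointness is not involved.

The Cheeger constant divides by β⁺, which grows at the same rate as the edge weights. For U = [N+1,
2N] the boundary has order N³ and the volume order N⁴, so the ratio tends to zero. -/

lemma subScalar_apply (T : E →ₗ.[ℂ] E) (z : ℂ) (u : T.domain) :
    subScalar T z u = T u - z • (u : E) := rfl

/-- The image of a closed subspace under `T - z` is closed if `T` is closed and `T - z` is bounded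
below on that subspace. -/
lemma isClosed_image_subScalar [CompleteSpace E] {T : E →ₗ.[ℂ] E} (hT : T.IsClosed) {z : ℂ}
    {W : Submodule ℂ E} (hW : IsClosed (W : Set E)) {c : ℝ} (hc : 0 < c)
    (hb : ∀ u : T.domain, (u : E) ∈ W → c * ‖(u : E)‖ ≤ ‖subScalar T z u‖) :
    IsClosed {v | ∃ u : T.domain, (u : E) ∈ W ∧ subScalar T z u = v} := by
  refine IsSeqClosed.isClosed fun w v hw hv => ?_
  choose u huW hu using hw
  have hcau : CauchySeq fun m => (u m : E) := by
    rw [Metric.cauchySeq_iff']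
    intro ε hε
    obtain ⟨N, hN⟩ := Metric.cauchySeq_iff'.1 hv.cauchySeq (c * ε) (by positivity)
    refine ⟨N, fun m hm => ?_⟩
    have h1 := hb (u m - u N) (W.sub_mem (huW m) (huW N))
    rw [map_sub, hu, hu, ← dist_eq_norm] at h1
    have h2 := h1.trans_lt (hN m hm)
    rw [dist_eq_norm]
    exact lt_of_mul_lt_mul_left h2 hc.le
  obtain ⟨x, hx⟩ := cauchySeq_tendsto_of_complete hcau
  have hmem : (x, v + z • x) ∈ T.graph := by
    refine hT.mem_of_tendsto (hx.prodMk_nhds (hv.add (hx.const_smul z)))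
      (Eventually.of_forall fun m => ?_)
    have : w m + z • (u m : E) = T (u m) := by rw [← hu, subScalar_apply]; abel
    rw [this]
    exact T.mem_graph _
  obtain ⟨y, hy, hy'⟩ := T.mem_graph_iff.1 hmem
  simp only at hy hy'
  refine ⟨y, hy ▸ hW.mem_of_tendsto hx (Eventually.of_forall huW), ?_⟩
  rw [subScalar_apply, hy, hy']
  abel

/-- A closed operator with `T - z` bounded below and of dense range has `z` in its resolvent set. -/
lemma notMem_pmapSpectrum_of_bound [CompleteSpace E] {T : E →ₗ.[ℂ] E} (hT : T.IsClosed) {z : ℂ}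
    {c : ℝ} (hc : 0 < c) (hb : ∀ u : T.domain, c * ‖(u : E)‖ ≤ ‖subScalar T z u‖)
    (hd : ∀ v : E, (∀ u : T.domain, inner ℂ v (subScalar T z u) = 0) → v = 0) :
    z ∉ pmapSpectrum T := by
  have hcl : IsClosed (LinearMap.range (subScalar T z) : Set E) := by
    convert isClosed_image_subScalar hT (W := ⊤) isClosed_univ hc (fun u _ => hb u) using 1
    ext v
    simp
  have htop : LinearMap.range (subScalar T z) = ⊤ := by
    have : CompleteSpace (LinearMap.range (subScalar T z)) := hcl.completeSpace_coe
    rw [← Submodule.orthogonal_eq_bot_iff, Submodule.eq_bot_iff]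
    intro v hv
    exact hd v fun u => (Submodule.mem_orthogonal' _ _).1 hv _ (LinearMap.mem_range_self _ u)
  have hinj : Function.Injective (subScalar T z) := by
    rw [← LinearMap.ker_eq_bot, LinearMap.ker_eq_bot']
    intro u hu
    have := hb u
    rw [hu, norm_zero] at this
    have h0 : ‖(u : E)‖ ≤ 0 := by
      by_contra! h
      nlinarith
    exact Subtype.ext (norm_le_zero_iff.1 h0)
  let e := LinearEquiv.ofBijective (subScalar T z) ⟨hinj, LinearMap.range_eq_top.1 htop⟩
  have he : ∀ v, subScalar T z (e.symm v) = v := fun v => e.apply_symm_apply v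
  let R : E →L[ℂ] E := LinearMap.mkContinuous (T.domain.subtype ∘ₗ e.symm.toLinearMap) c⁻¹
    fun v => by
      have := hb (e.symm v)
      rw [he] at this
      rw [← div_eq_inv_mul, le_div_iff₀ hc, mul_comm]
      exact this
  rw [pmapSpectrum, Set.mem_ofPred_eq, not_not]
  refine ⟨R, fun u => ?_, fun v => ⟨(e.symm v).2, he v⟩⟩
  exact congrArg Subtype.val (e.symm_apply_apply u)

/-- A closed operator whose domain embeds compactly has no essential spectrum. -/
lemma essSpectrum_eq_empty_of_compact [CompleteSpace E] {T : E →ₗ.[ℂ] E} (hT : T.IsClosed)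
    (hK : ∀ C : ℝ, ∃ K : Set E, IsCompact K ∧
      ∀ u : T.domain, ‖(u : E)‖ ≤ C → ‖T u‖ ≤ C → (u : E) ∈ K) :
    essSpectrum T = ∅ := by
  rw [Set.eq_empty_iff_forall_notMem]
  intro z hz
  set N : Submodule ℂ E := (LinearMap.ker (subScalar T z)).map T.domain.subtype with hN
  have hNmem : ∀ x, x ∈ N ↔ (x, z • x) ∈ T.graph := by
    intro x
    rw [T.mem_graph_iff, hN, Submodule.mem_map]
    constructor
    · rintro ⟨u, hu, rfl⟩
      exact ⟨u, rfl, by simpa [subScalar_apply, sub_eq_zero] using hu⟩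
    · rintro ⟨u, hu, h2⟩
      simp only at hu h2
      exact ⟨u, by simp [subScalar_apply, h2, hu], hu⟩
  have hNcl : IsClosed (N : Set E) := by
    have : (N : Set E) = (fun x : E => (x, z • x)) ⁻¹' (T.graph : Set (E × E)) := by
      ext x; exact hNmem x
    rw [this]
    exact IsClosed.preimage (by fun_prop) hT
  have hNfin : FiniteDimensional ℂ N := by
    -- On the eigenspace ‖Tu‖ = ‖z‖‖u‖, so its unit ball is graph-norm bounded, hence compact, and
    -- Riesz's theorem applies.
    obtain ⟨K, hKc, hKm⟩ := hK (max 1 ‖z‖)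
    refine FiniteDimensional.of_isCompact_closedBall₀ ℂ (r := 1) one_pos ?_
    rw [Subtype.isCompact_iff]
    refine hKc.of_isClosed_subset ?_ ?_
    · have := (hNcl.isClosedEmbedding_subtypeVal).isClosedMap (Metric.closedBall (0 : N) 1)
        Metric.isClosed_closedBall
      exact this
    · rintro _ ⟨x, hx, rfl⟩
      obtain ⟨u, hu, h2⟩ := T.mem_graph_iff.1 ((hNmem x).1 x.2)
      simp only at hu h2
      rw [← hu]
      have hx1 : ‖(x : E)‖ ≤ 1 := by simpa using hx
      refine hKm u (by rw [hu]; exact hx1.trans (le_max_left _ _)) ?_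
      rw [h2, norm_smul]
      exact (mul_le_of_le_one_right (norm_nonneg z) hx1).trans (le_max_right _ _)
  have hker : FiniteDimensional ℂ (LinearMap.ker (subScalar T z)) :=
    LinearEquiv.finiteDimensional
      (Submodule.equivMapOfInjective T.domain.subtype Subtype.val_injective _).symm
  rcases hz with hz | hz
  swap
  · exact hz hker
  refine hz ?_
  -- Otherwise unit vectors in Nᗮ with (T - z)u → 0 would have a convergent subsequence. By
  -- closedness of T its limit is a unit vector lying in both N and Nᗮ.
  have hbound : ∃ c : ℝ, 0 < c ∧
      ∀ u : T.domain, (u : E) ∈ Nᗮ → c * ‖(u : E)‖ ≤ ‖subScalar T z u‖ := by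
    by_contra! hcon
    have hseq : ∀ m : ℕ, ∃ u : T.domain, (u : E) ∈ Nᗮ ∧ ‖(u : E)‖ = 1 ∧
        ‖subScalar T z u‖ < 1 / ((m : ℝ) + 1) := by
      intro m
      obtain ⟨u, hu, hlt⟩ := hcon (1 / ((m : ℝ) + 1)) (by positivity)
      have hpos : 0 < ‖(u : E)‖ := by
        by_contra! h
        have h0 : ‖(u : E)‖ = 0 := le_antisymm h (norm_nonneg _)
        rw [h0, mul_zero] at hlt
        exact absurd (norm_nonneg _) (not_le.2 hlt)
      refine ⟨((‖(u : E)‖⁻¹ : ℝ) : ℂ) • u, Submodule.smul_mem _ _ hu, ?_, ?_⟩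
      · simp [norm_smul, hpos.ne']
      · rw [map_smul, norm_smul, Complex.norm_real, norm_inv, norm_norm, inv_mul_lt_iff₀ hpos,
          mul_comm]
        exact hlt
    choose u huN hu1 hulim using hseq
    obtain ⟨K, hKc, hKm⟩ := hK (1 + ‖z‖)
    have huK : ∀ m, (u m : E) ∈ K := by
      intro m
      refine hKm _ (by rw [hu1]; linarith [norm_nonneg z]) ?_
      have h1 : T (u m) = subScalar T z (u m) + z • (u m : E) := by rw [subScalar_apply]; abel
      have h2 : 1 / ((m : ℝ) + 1) ≤ 1 := by
        rw [div_le_one (by positivity)]; linarith [(Nat.cast_nonneg m : (0 : ℝ) ≤ m)]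
      rw [h1]
      refine (norm_add_le _ _).trans ?_
      rw [norm_smul, hu1, mul_one]
      linarith [hulim m]
    obtain ⟨x, -, φ, hφ, hx⟩ := hKc.tendsto_subseq huK
    have hw : Tendsto (fun m => subScalar T z (u m)) atTop (𝓝 0) :=
      squeeze_zero_norm (fun m => (hulim m).le) tendsto_one_div_add_atTop_nhds_zero_nat
    have hw' := hw.comp hφ.tendsto_atTop
    have hmem : (x, 0 + z • x) ∈ T.graph := by
      refine hT.mem_of_tendsto (hx.prodMk_nhds (hw'.add (hx.const_smul z)))
        (Eventually.of_forall fun m => ?_)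
      have : (T (u (φ m))) = ((fun m => subScalar T z (u m)) ∘ φ) m
          + z • ((fun m => (u m : E)) ∘ φ) m := by
        simp [subScalar_apply]
      rw [← this]
      exact T.mem_graph _
    rw [zero_add] at hmem
    have hxN : x ∈ N := (hNmem x).2 hmem
    have hxo : x ∈ Nᗮ := (Submodule.isClosed_orthogonal N).mem_of_tendsto hx
      (Eventually.of_forall fun m => huN _)
    have hx0 : x = 0 := by
      have := (Submodule.mem_orthogonal _ _).1 hxo x hxN
      exact inner_self_eq_zero.1 this
    have hx1 : ‖x‖ = 1 := tendsto_nhds_unique hx.norm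
      (tendsto_const_nhds.congr fun m => (hu1 (φ m)).symm)
    rw [hx0, norm_zero] at hx1
    exact zero_ne_one hx1
  obtain ⟨c, hc, hb⟩ := hbound
  -- Subtracting the projection onto N stays in the domain and does not change (T - z)u, so the
  -- whole range is already the image of Nᗮ.
  convert isClosed_image_subScalar hT (Submodule.isClosed_orthogonal N) hc hb using 1
  ext v
  constructor
  · rintro ⟨u, rfl⟩
    obtain ⟨k, hk, hku⟩ := Submodule.mem_map.1
      (show N.starProjection (u : E) ∈ N from Submodule.starProjection_apply_mem _ _)
    refine ⟨u - k, ?_, ?_⟩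
    · have h := Submodule.sub_starProjection_mem_orthogonal (K := N) (u : E)
      rw [← hku] at h
      exact h
    · rw [map_sub, LinearMap.mem_ker.1 hk, sub_zero]
  · rintro ⟨u, -, rfl⟩
    exact ⟨u, rfl⟩

/-- The graph of the closure is the closure of the graph, so any closed relation between f and Af
passes to the closure. -/
lemma closure_induction {A : E →ₗ.[ℂ] E} (hA : A.IsClosable) {P : E → E → Prop}
    (hP : IsClosed {p : E × E | P p.1 p.2}) (h : ∀ f : A.domain, P f (A f))
    (f : A.closure.domain) : P f (A.closure f) := by
  have h1 : ((f : E), A.closure f) ∈ (A.graph.topologicalClosure : Set (E × E)) := by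
    rw [hA.graph_closure_eq_closure_graph]
    exact A.closure.mem_graph f
  rw [Submodule.topologicalClosure_coe] at h1
  refine closure_minimal (s := (A.graph : Set (E × E))) ?_ hP h1
  rintro ⟨x, y⟩ hxy
  obtain ⟨u, hu, h2⟩ := A.mem_graph_iff.1 hxy
  simp only at hu h2
  subst hu h2
  exact h u

lemma closure_form_bound {A : E →ₗ.[ℂ] E} (hA : A.IsClosable) {m : ℝ}
    (h : ∀ f : A.domain, m * ‖(f : E)‖ ^ 2 ≤ (inner ℂ (f : E) (A f)).re) (f : A.closure.domain) :
    m * ‖(f : E)‖ ^ 2 ≤ (inner ℂ (f : E) (A.closure f)).re := by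
  refine closure_induction hA (P := fun x y => m * ‖x‖ ^ 2 ≤ (inner ℂ x y).re) ?_ h f
  exact isClosed_le (by fun_prop)
    (Complex.continuous_re.comp (continuous_fst.inner continuous_snd))

/-- Cauchy–Schwarz applied to the real part of ⟨u, (T - t)u⟩; symmetry of T plays no role. -/
lemma subScalar_bound_of_form {T : E →ₗ.[ℂ] E} {m t : ℝ}
    (h : ∀ f : T.domain, m * ‖(f : E)‖ ^ 2 ≤ (inner ℂ (f : E) (T f)).re) (u : T.domain) :
    (m - t) * ‖(u : E)‖ ≤ ‖subScalar T (t : ℂ) u‖ := by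
  have h1 : (inner ℂ (u : E) (subScalar T (t : ℂ) u)).re
      = (inner ℂ (u : E) (T u)).re - t * ‖(u : E)‖ ^ 2 := by
    rw [subScalar_apply, inner_sub_right, inner_smul_right, inner_self_eq_norm_sq_to_K]
    simp [← Complex.ofReal_pow]
  have h2 := (Complex.re_le_norm _).trans (norm_inner_le_norm (𝕜 := ℂ) (u : E)
    (subScalar T (t : ℂ) u))
  have h3 := h u
  rcases (norm_nonneg (u : E)).eq_or_lt with h0 | h0
  · rw [← h0, mul_zero]; exact norm_nonneg _
  · refine le_of_mul_le_mul_left ?_ h0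
    nlinarith

lemma isClosable_of_graph_closure {A C : E →ₗ.[ℂ] E} (h : A.graph.topologicalClosure = C.graph) :
    A.IsClosable ∧ A.closure = C := by
  have hA : A.IsClosable := ⟨C, h⟩
  exact ⟨hA, LinearPMap.eq_of_eq_graph (hA.graph_closure_eq_closure_graph.symm.trans h)⟩

lemma mem_graph_of_perturbation {A B : E →ₗ.[ℂ] E} {K : E →L[ℂ] E} (hdom : B.domain = A.domain)
    (hB : ∀ (f : B.domain) (g : A.domain), (f : E) = g → B f = A g + K g) (x y : E) :
    (x, y) ∈ B.graph ↔ (x, y - K x) ∈ A.graph := by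
  rw [B.mem_graph_iff, A.mem_graph_iff]
  constructor
  · rintro ⟨f, hf, h⟩
    simp only at hf h
    refine ⟨⟨f, hdom.le f.2⟩, hf, ?_⟩
    subst hf h
    rw [hB f ⟨f, hdom.le f.2⟩ rfl]
    simp
  · rintro ⟨f, hf, h⟩
    simp only at hf h
    refine ⟨⟨f, hdom.ge f.2⟩, hf, ?_⟩
    subst hf
    rw [hB _ f rfl, h]
    simp

/-- The closure of a bounded perturbation is the bounded perturbation of the closure. -/
lemma closure_of_perturbation {A B : E →ₗ.[ℂ] E} {K : E →L[ℂ] E} (hdom : B.domain = A.domain)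
    (hB : ∀ (f : B.domain) (g : A.domain), (f : E) = g → B f = A g + K g) (hA : A.IsClosable) :
    B.IsClosable ∧ B.closure.domain = A.closure.domain ∧
      ∀ (f : B.closure.domain) (g : A.closure.domain), (f : E) = g →
        B.closure f = A.closure g + K g := by
  let C : E →ₗ.[ℂ] E := ⟨A.closure.domain, A.closure.toFun + K.toLinearMap ∘ₗ A.closure.domain.subtype⟩
  have hC : ∀ x y, (x, y) ∈ C.graph ↔ (x, y - K x) ∈ A.closure.graph :=
    mem_graph_of_perturbation rfl (fun f g h => by
      obtain rfl : f = g := Subtype.ext h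
      rfl)
  -- The shear (x, y) ↦ (x, y - Kx) carries the graph of B onto that of A. Being a homeomorphism, it
  -- commutes with taking closures.
  let e : E × E ≃ₜ E × E :=
    { toFun := fun p => (p.1, p.2 - K p.1)
      invFun := fun p => (p.1, p.2 + K p.1)
      left_inv := fun p => by simp
      right_inv := fun p => by simp
      continuous_toFun := by fun_prop
      continuous_invFun := by fun_prop }
  have hpre : (B.graph : Set (E × E)) = e ⁻¹' (A.graph : Set (E × E)) := by
    ext ⟨x, y⟩
    exact mem_graph_of_perturbation hdom hB x y
  have hgr : B.graph.topologicalClosure = C.graph := by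
    refine SetLike.coe_injective ?_
    rw [Submodule.topologicalClosure_coe, hpre, ← e.preimage_closure,
      ← Submodule.topologicalClosure_coe, hA.graph_closure_eq_closure_graph]
    ext ⟨x, y⟩
    exact (hC x y).symm
  obtain ⟨h1, h2⟩ := isClosable_of_graph_closure hgr
  refine ⟨h1, by rw [h2], ?_⟩
  rw [h2]
  intro f g h
  obtain rfl : f = g := Subtype.ext h
  rfl

variable [CompleteSpace E]

lemma mem_graph_adjoint_iff {A : E →ₗ.[ℂ] E} (hd : Dense (A.domain : Set E)) (y w : E) :
    (y, w) ∈ (LinearPMap.adjoint A).graph ↔ ∀ f : A.domain, inner ℂ (A f) y = inner ℂ (f : E) w := by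
  rw [LinearPMap.adjoint_graph_eq_graph_adjoint hd, Submodule.mem_adjoint_iff]
  constructor
  · intro h f
    exact sub_eq_zero.1 (h _ _ (A.mem_graph f))
  · intro h a b hab
    obtain ⟨u, hu, h2⟩ := A.mem_graph_iff.1 hab
    simp only at hu h2
    subst hu h2
    exact sub_eq_zero.2 (h u)

lemma adjoint_closure {A : E →ₗ.[ℂ] E} (hd : Dense (A.domain : Set E)) (hA : A.IsClosable) :
    LinearPMap.adjoint A.closure = LinearPMap.adjoint A := by
  have hd' : Dense (A.closure.domain : Set E) := hd.mono A.le_closure.1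
  refine LinearPMap.eq_of_eq_graph ?_
  ext ⟨y, w⟩
  rw [mem_graph_adjoint_iff hd, mem_graph_adjoint_iff hd']
  constructor
  · intro h f
    have h2 := h ⟨f, A.le_closure.1 f.2⟩
    rwa [← A.le_closure.2 (x := f) (y := ⟨f, A.le_closure.1 f.2⟩) rfl] at h2
  · intro h
    refine closure_induction hA (P := fun a b => inner ℂ b y = inner ℂ a w) ?_ h
    exact isClosed_eq (by fun_prop) (by fun_prop)

/-- A nonnegative symmetric operator `A` such that `A + 1` has dense range is essentially
self-adjoint. -/
lemma essentiallySelfAdjoint_of_dense_range {A : E →ₗ.[ℂ] E} (hd : Dense (A.domain : Set E))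
    (hs : A.IsFormalAdjoint A) (h0 : ∀ f : A.domain, 0 ≤ (inner ℂ (f : E) (A f)).re)
    (hr : ∀ v : E, (∀ f : A.domain, inner ℂ v (A f + f) = 0) → v = 0) :
    EssentiallySelfAdjoint A := by
  have hle : A ≤ LinearPMap.adjoint A := hs.le_adjoint hd
  have hadj : (LinearPMap.adjoint A).IsClosed := LinearPMap.adjoint_isClosed hd
  have hA : A.IsClosable := hadj.isClosable.leIsClosable hle
  refine ⟨hA, ?_⟩
  rw [LinearPMap.isSelfAdjoint_def, adjoint_closure hd hA]
  have hform := closure_form_bound hA (m := 0) (by simpa using h0)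
  have hb := subScalar_bound_of_form (t := -1) hform
  have hres : ((-1 : ℝ) : ℂ) ∉ pmapSpectrum A.closure := by
    refine notMem_pmapSpectrum_of_bound hA.closure_isClosed one_pos (by simpa using hb) ?_
    intro v hv
    refine hr v fun f => ?_
    have h2 := hv ⟨f, A.le_closure.1 f.2⟩
    rw [subScalar_apply, ← A.le_closure.2 (x := f) (y := ⟨f, A.le_closure.1 f.2⟩) rfl] at h2
    simpa using h2
  rw [pmapSpectrum, Set.mem_ofPred_eq, not_not] at hres
  obtain ⟨R, -, hR⟩ := hres
  have hcle : A.closure.graph ≤ (LinearPMap.adjoint A).graph := by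
    rw [← hA.graph_closure_eq_closure_graph]
    exact Submodule.topologicalClosure_minimal _ (LinearPMap.le_graph_of_le hle) hadj
  refine LinearPMap.eq_of_eq_graph (le_antisymm ?_ hcle)
  rintro ⟨y, w⟩ hyw
  -- Given w = A*y, solve (Ā + 1)u = w + y. Then u - y lies in the kernel of A* + 1, which is
  -- trivial because A + 1 has dense range; hence y = u belongs to the domain of Ā.
  obtain ⟨hdom, hu⟩ := hR (w + y)
  set u : A.closure.domain := ⟨R (w + y), hdom⟩ with hudef
  have hug : ((u : E), A.closure u) ∈ (LinearPMap.adjoint A).graph :=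
    hcle (A.closure.mem_graph u)
  rw [subScalar_apply] at hu
  have hsub := (LinearPMap.adjoint A).graph.sub_mem hug hyw
  rw [Prod.mk_sub_mk, mem_graph_adjoint_iff hd] at hsub
  have hzero : (u : E) - y = 0 := by
    refine hr _ fun f => ?_
    have h1 : A.closure u - w = -((u : E) - y) := by
      have : A.closure u = w + y + ((-1 : ℝ) : ℂ) • (u : E) := by rw [← hu]; abel
      rw [this]; push_cast; module
    have h2 := hsub f
    rw [h1, inner_neg_right] at h2
    rw [← inner_conj_symm, inner_add_left, h2]
    simp
  have huy : (u : E) = y := sub_eq_zero.1 hzero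
  have hAw : A.closure u = w := by
    rw [huy] at hu
    push_cast at hu
    have : A.closure u + y = w + y := by simpa using hu
    exact add_right_cancel this
  rw [← huy, ← hAw]
  exact A.closure.mem_graph u

lemma selfAdjoint_inner_symm {T : E →ₗ.[ℂ] E} (hT : IsSelfAdjoint T) (f g : T.domain) :
    inner ℂ (T f) (g : E) = inner ℂ (f : E) (T g) := by
  have h := LinearPMap.adjoint_isFormalAdjoint hT.dense_domain
  rw [LinearPMap.isSelfAdjoint_def.1 hT] at h
  exact h f g

/-- The spectrum of a self-adjoint operator lies above every lower bound of its form. -/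
lemma notMem_pmapSpectrum_of_lt {T : E →ₗ.[ℂ] E} (hT : IsSelfAdjoint T) {m t : ℝ} (ht : t < m)
    (h : ∀ f : T.domain, m * ‖(f : E)‖ ^ 2 ≤ (inner ℂ (f : E) (T f)).re) :
    (t : ℂ) ∉ pmapSpectrum T := by
  have hb := subScalar_bound_of_form (t := t) h
  refine notMem_pmapSpectrum_of_bound hT.isClosed (sub_pos.2 ht) hb ?_
  intro v hv
  -- A vector orthogonal to the range of T - t is an eigenvector of T* = T for t, which the lower
  -- bound on T - t excludes.
  have hmem : (v, (t : ℂ) • v) ∈ (LinearPMap.adjoint T).graph := by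
    rw [mem_graph_adjoint_iff hT.dense_domain]
    intro f
    have h1 := hv f
    rw [subScalar_apply, inner_sub_right, inner_smul_right, sub_eq_zero] at h1
    rw [← inner_conj_symm, h1, inner_smul_right, map_mul, Complex.conj_ofReal, inner_conj_symm]
  rw [LinearPMap.isSelfAdjoint_def.1 hT] at hmem
  obtain ⟨u, hu, h2⟩ := T.mem_graph_iff.1 hmem
  simp only at hu h2
  have h3 := hb u
  rw [subScalar_apply, h2, hu, sub_self, norm_zero] at h3
  have h4 : ‖v‖ ≤ 0 := by
    by_contra! h5
    nlinarith [sub_pos.2 ht]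
  exact norm_le_zero_iff.1 h4

/-- The bottom of the spectrum of the closure of an essentially self-adjoint operator, semibounded
from below, is the infimum of the Rayleigh quotient. -/
lemma lambdaOne_closure_eq_rayleighInf {A : E →ₗ.[ℂ] E} (hA : EssentiallySelfAdjoint A) {C : ℝ}
    (hC : ∀ f : A.domain, C * ‖(f : E)‖ ^ 2 ≤ (inner ℂ (f : E) (A f)).re)
    (hne : ∃ f : A.domain, f ≠ 0) :
    lambdaOne A.closure = rayleighInf A := by
  set m := rayleighInf A with hm
  have hunit : ∀ f : A.domain, f ≠ 0 → ∃ g : A.domain, ‖(g : E)‖ = 1 ∧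
      (inner ℂ (f : E) (A f)).re = ‖(f : E)‖ ^ 2 * (inner ℂ (g : E) (A g)).re := by
    intro f hf
    have hpos : 0 < ‖(f : E)‖ := norm_pos_iff.2 (by simpa using hf)
    refine ⟨((‖(f : E)‖⁻¹ : ℝ) : ℂ) • f, ?_, ?_⟩
    · simp [norm_smul, hpos.ne']
    · rw [A.map_smul, Submodule.coe_smul, inner_smul_left, inner_smul_right, Complex.conj_ofReal,
        Complex.re_ofReal_mul, Complex.re_ofReal_mul]
      field_simp
  have hbdd : BddBelow {t : ℝ | ∃ f : A.domain, ‖(f : E)‖ = 1 ∧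
      t = (inner ℂ (f : E) (A f)).re} := by
    refine ⟨C, ?_⟩
    rintro _ ⟨f, hf, rfl⟩
    simpa [hf] using hC f
  have hmA : ∀ f : A.domain, m * ‖(f : E)‖ ^ 2 ≤ (inner ℂ (f : E) (A f)).re := by
    intro f
    by_cases hf : f = 0
    · simp [hf]
    obtain ⟨g, hg, hfg⟩ := hunit f hf
    have : m ≤ (inner ℂ (g : E) (A g)).re := csInf_le hbdd ⟨g, hg, rfl⟩
    rw [hfg, mul_comm]
    gcongr
  have hmT := closure_form_bound hA.1 hmA
  have hlow : ∀ t ∈ {t : ℝ | (t : ℂ) ∈ pmapSpectrum A.closure}, m ≤ t := by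
    intro t ht
    by_contra! hlt
    exact notMem_pmapSpectrum_of_lt hA.2 hlt hmT ht
  -- Both remaining goals say that m is in the spectrum: once for the upper bound, once for
  -- nonemptiness, without which `sInf` would be the default value 0.
  refine le_antisymm (csInf_le ⟨m, hlow⟩ ?_) (le_csInf ⟨m, ?_⟩ hlow) <;>
  · rw [Set.mem_ofPred_eq]
    by_contra hres
    rw [pmapSpectrum, Set.mem_ofPred_eq, not_not] at hres
    obtain ⟨R, -, hR⟩ := hres
    have hpos : 0 < ‖R‖ + 1 := by positivity
    have hkey : m + (‖R‖ + 1)⁻¹ ≤ m := by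
      refine le_csInf ?_ ?_
      · obtain ⟨f, hf⟩ := hne
        obtain ⟨g, hg, -⟩ := hunit f hf
        exact ⟨_, g, hg, rfl⟩
      rintro _ ⟨f, hf, rfl⟩
      have hAf : A f = A.closure ⟨f, A.le_closure.1 f.2⟩ := A.le_closure.2 rfl
      set g : A.closure.domain := ⟨f, A.le_closure.1 f.2⟩ with hg
      have hfg : (f : E) = g := rfl
      rw [hAf, hfg]
      rw [hfg] at hf
      obtain ⟨hdom, hu⟩ := hR (g : E)
      set u : A.closure.domain := ⟨R (g : E), hdom⟩ with hudef
      -- With s = 1/(‖R‖ + 1) and (T - m)u = g, positivity of the form of T - m at g - su gives ⟨g,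
      -- (T - m)g⟩ ≥ 2s - s²Re⟨g, u⟩ ≥ s. Every unit vector thus exceeds the infimum by s, a
      -- contradiction.
      have hq := hmT (g - ((‖R‖ + 1)⁻¹ : ℂ) • u)
      have hTu : A.closure u = (g : E) + (m : ℂ) • (u : E) := by
        rw [← hu, subScalar_apply]; abel
      have hsym : (inner ℂ (u : E) (A.closure g)).re = 1 + m * (inner ℂ (g : E) (u : E)).re := by
        rw [← selfAdjoint_inner_symm hA.2, hTu, inner_add_left, inner_smul_left,
          inner_self_eq_norm_sq_to_K, hf, Complex.conj_ofReal, Complex.add_re,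
          Complex.re_ofReal_mul, ← inner_conj_symm (u : E) (g : E), Complex.conj_re]
        simp
      have hgu : (inner ℂ (g : E) (A.closure u)).re = 1 + m * (inner ℂ (g : E) (u : E)).re := by
        rw [hTu, inner_add_right, inner_smul_right, inner_self_eq_norm_sq_to_K, hf,
          Complex.add_re, Complex.re_ofReal_mul]
        simp
      have huu : (inner ℂ (u : E) (A.closure u)).re
          = (inner ℂ (g : E) (u : E)).re + m * ‖(u : E)‖ ^ 2 := by
        rw [hTu, inner_add_right, inner_smul_right, inner_self_eq_norm_sq_to_K,
          Complex.add_re, Complex.re_ofReal_mul, ← inner_conj_symm, Complex.conj_re]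
        simp [← Complex.ofReal_pow]
      have hRb : (inner ℂ (g : E) (u : E)).re ≤ ‖R‖ := by
        refine (Complex.re_le_norm _).trans ((norm_inner_le_norm _ _).trans ?_)
        rw [hf, one_mul]
        simpa [hf] using R.le_opNorm (g : E)
      set s : ℝ := (‖R‖ + 1)⁻¹ with hs
      have hs' : ((‖R‖ : ℂ) + 1)⁻¹ = (s : ℂ) := by rw [hs]; push_cast; rfl
      have hss : s * (‖R‖ + 1) = 1 := inv_mul_cancel₀ hpos.ne'
      have hsp : 0 < s := inv_pos.2 hpos
      rw [hs', A.closure.map_sub, A.closure.map_smul, Submodule.coe_sub, Submodule.coe_smul,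
        @norm_sub_sq ℂ, hf, norm_smul, inner_smul_right] at hq
      simp only [inner_sub_left, inner_sub_right, inner_smul_left, inner_smul_right,
        Complex.conj_ofReal, Complex.sub_re, Complex.re_ofReal_mul, hsym, hgu, huu,
        Complex.norm_real, RCLike.re_to_complex, Real.norm_eq_abs, mul_pow, sq_abs] at hq
      nlinarith [mul_le_mul_of_nonneg_left hRb (sq_nonneg s), hss]
    have : 0 < (‖R‖ + 1)⁻¹ := inv_pos.2 hpos
    linarith

/-! ### Bounded skew-adjoint perturbations. -/

section Perturbation

variable {A B : E →ₗ.[ℂ] E} {K : E →L[ℂ] E}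

/-- The adjoint of a perturbation of an essentially self-adjoint operator by a bounded
skew-adjoint operator. -/
lemma adjoint_of_skew_perturbation (hdom : B.domain = A.domain)
    (hB : ∀ (f : B.domain) (g : A.domain), (f : E) = g → B f = A g + K g)
    (hd : Dense (A.domain : Set E)) (hA : EssentiallySelfAdjoint A)
    (hK : ∀ x y, inner ℂ (K x) y = -inner ℂ x (K y)) (y w : E) :
    (y, w) ∈ (LinearPMap.adjoint B).graph ↔ (y, w + K y) ∈ A.closure.graph := by
  have h1 := hA.2
  rw [LinearPMap.isSelfAdjoint_def, adjoint_closure hd hA.1] at h1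
  rw [← h1, mem_graph_adjoint_iff hd, mem_graph_adjoint_iff (by rw [hdom]; exact hd)]
  constructor
  · intro h f
    have h2 := h ⟨f, hdom.ge f.2⟩
    rw [hB _ f rfl, inner_add_left, hK] at h2
    rw [inner_add_right, ← h2]
    ring
  · intro h f
    have h2 := h ⟨f, hdom.le f.2⟩
    rw [hB f ⟨f, hdom.le f.2⟩ rfl, inner_add_left, hK, h2, inner_add_right]
    ring

/-- The symmetric part `(B̄ + B*)/2` of a bounded skew-adjoint perturbation `B` of `A` is `Ā`. -/
lemma half_closure_add_adjoint (hdom : B.domain = A.domain)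
    (hB : ∀ (f : B.domain) (g : A.domain), (f : E) = g → B f = A g + K g)
    (hd : Dense (A.domain : Set E)) (hA : EssentiallySelfAdjoint A)
    (hK : ∀ x y, inner ℂ (K x) y = -inner ℂ x (K y)) :
    (1 / 2 : ℂ) • (B.closure + LinearPMap.adjoint B) = A.closure := by
  -- The closure of B is Ā + K and its adjoint is Ā - K, on the same domain, so K cancels in the
  -- mean.
  obtain ⟨-, hcd, hcB⟩ := closure_of_perturbation hdom hB hA.1
  have hadj := adjoint_of_skew_perturbation hdom hB hd hA hK
  have had : (LinearPMap.adjoint B).domain = A.closure.domain := by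
    ext y
    rw [LinearPMap.mem_domain_iff, LinearPMap.mem_domain_iff]
    constructor
    · rintro ⟨w, hw⟩
      exact ⟨_, (hadj y w).1 hw⟩
    · rintro ⟨w, hw⟩
      exact ⟨w - K y, (hadj y _).2 (by simpa using hw)⟩
  have hdomS : (B.closure + LinearPMap.adjoint B).domain = A.closure.domain := by
    rw [LinearPMap.add_domain, hcd, had, inf_idem]
  refine LinearPMap.ext (by rw [LinearPMap.smul_domain, hdomS]) ?_
  intro x hx hx'
  have hx1 : x ∈ B.closure.domain := by rw [hcd]; exact hx'
  have hx2 : x ∈ (LinearPMap.adjoint B).domain := by rw [had]; exact hx'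
  have e1 := hcB ⟨x, hx1⟩ ⟨x, hx'⟩ rfl
  have e2 : LinearPMap.adjoint B ⟨x, hx2⟩ + K x = A.closure ⟨x, hx'⟩ := by
    have := (hadj x (LinearPMap.adjoint B ⟨x, hx2⟩)).1 ((LinearPMap.adjoint B).mem_graph ⟨x, hx2⟩)
    exact A.closure.mem_graph_snd_inj this (A.closure.mem_graph ⟨x, hx'⟩) rfl
  have e3 : ((1 / 2 : ℂ) • (B.closure + LinearPMap.adjoint B)) ⟨x, hx⟩
      = (1 / 2 : ℂ) • (B.closure ⟨x, hx1⟩ + LinearPMap.adjoint B ⟨x, hx2⟩) := rfl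
  rw [e3, e1, ← e2]
  module

end Perturbation

end Operators

/-! ### Telescoping sums over ℤ and the Hardy inequality. -/

section IntegerSums

lemma finite_support_shift {M : Type*} [Zero M] {f : ℤ → M} (hf : (Function.support f).Finite)
    (c : ℤ) : (Function.support fun k => f (k + c)).Finite :=
  hf.preimage (add_left_injective c).injOn

lemma tsum_shift {M : Type*} [AddCommMonoid M] [TopologicalSpace M] (f : ℤ → M) (c : ℤ) :
    ∑' k, f (k + c) = ∑' k, f k :=
  (Equiv.addRight c).tsum_eq f

lemma summable_of_support_subset {M : Type*} [AddCommMonoid M] [TopologicalSpace M] {f : ℤ → M}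
    {s : Set ℤ} (hs : s.Finite) (h : ∀ k, k ∉ s → f k = 0) : Summable f :=
  summable_of_hasFiniteSupport (hs.subset fun k hk => by
    by_contra h'
    exact hk (h k h'))

/-- Summation of a pointwise bound up to a telescoping term. -/
lemma tsum_le_tsum_of_telescope {D w e : ℤ → ℝ} {s : Set ℤ} (hs : s.Finite)
    (hD : ∀ k, k ∉ s → D k = 0) (hw : ∀ k, k ∉ s → w k = 0) (he : ∀ k, k ∉ s → e k = 0)
    (h : ∀ k, w k + e k - e (k + 1) ≤ D k) : ∑' k, w k ≤ ∑' k, D k := by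
  have hwS := summable_of_support_subset hs hw
  have heS := summable_of_support_subset hs he
  have heS' : Summable fun k => e (k + 1) := (Equiv.addRight (1 : ℤ)).summable_iff.2 heS
  have h1 : ∑' k, (w k + e k - e (k + 1)) = ∑' k, w k := by
    rw [(hwS.add heS).tsum_sub heS', hwS.tsum_add heS, tsum_shift e 1]
    ring
  rw [← h1]
  exact ((hwS.add heS).sub heS').tsum_le_tsum h (summable_of_support_subset hs hD)

lemma sq_norm_sub_norm_le (x y : ℂ) : (‖x‖ - ‖y‖) ^ 2 ≤ ‖x - y‖ ^ 2 :=
  sq_le_sq' (by linarith [norm_sub_rev x y ▸ norm_sub_norm_le y x]) (norm_sub_norm_le x y)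

/-- The pointwise inequality behind the Hardy inequality. -/
lemma hardy_pointwise {t : ℝ} (ht : 0 ≤ t) (x y : ℂ) :
    (t / 2 - 1 / 4) * ‖x‖ ^ 2 - t / 2 * ‖y‖ ^ 2 ≤ t ^ 2 * ‖x - y‖ ^ 2 := by
  have h := mul_le_mul_of_nonneg_left (sq_norm_sub_norm_le x y) (sq_nonneg t)
  refine le_trans ?_ h
  generalize ‖x‖ = X
  generalize ‖y‖ = Y
  have hA : 0 < t ^ 2 - t / 2 + 1 / 4 := by nlinarith [sq_nonneg (t - 1 / 4)]
  -- Multiply by the positive coefficient of X² and complete the square; the determinant of the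
  -- quadratic form is exactly t/8.
  have hQ : 0 ≤ (t ^ 2 - t / 2 + 1 / 4) *
      (t ^ 2 * (X - Y) ^ 2 - ((t / 2 - 1 / 4) * X ^ 2 - t / 2 * Y ^ 2)) := by
    have : (t ^ 2 - t / 2 + 1 / 4) *
        (t ^ 2 * (X - Y) ^ 2 - ((t / 2 - 1 / 4) * X ^ 2 - t / 2 * Y ^ 2))
        = ((t ^ 2 - t / 2 + 1 / 4) * X - t ^ 2 * Y) ^ 2 + t / 8 * Y ^ 2 := by ring
    rw [this]
    positivity
  linarith [nonneg_of_mul_nonneg_right hQ hA]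

/-- `hardy_pointwise` multiplied by t: a cubic weight pays for a quadratic telescoping term, whose
increments leave a gain linear in t. -/
lemma cubic_hardy_pointwise {t : ℝ} (ht : 0 ≤ t) (x y : ℂ) :
    (t ^ 2 / 2 - t / 4) * ‖x‖ ^ 2 - t ^ 2 / 2 * ‖y‖ ^ 2 ≤ t ^ 3 * ‖x - y‖ ^ 2 := by
  have h := mul_le_mul_of_nonneg_left (hardy_pointwise ht x y) ht
  calc _ = t * ((t / 2 - 1 / 4) * ‖x‖ ^ 2 - t / 2 * ‖y‖ ^ 2) := by ring
    _ ≤ t * (t ^ 2 * ‖x - y‖ ^ 2) := h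
    _ = _ := by ring

/-- The discrete Hardy inequality on `ℤ`. -/
lemma hardy_inequality (f : ℤ → ℂ) (hf : (Function.support f).Finite) :
    (1 / 4 : ℝ) * ∑' k : ℤ, ‖f k‖ ^ 2 ≤ ∑' k : ℤ, (k : ℝ) ^ 2 * ‖f (k - 1) - f k‖ ^ 2 := by
  rw [← tsum_mul_left, ← tsum_shift (fun k : ℤ => (k : ℝ) ^ 2 * ‖f (k - 1) - f k‖ ^ 2) 1]
  -- With t = |k + 1| the pointwise inequality becomes exactly 1/4 plus a telescoping term, with the
  -- two endpoints exchanged for negative k. The edge k = -1 has weight zero; the offset 1/4 makes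
  -- the two branches fit there.
  set ε : ℤ → ℝ := fun k => if 0 ≤ k then (k : ℝ) / 2 else (k : ℝ) / 2 + 1 / 4 with hε
  have hz : ∀ k, k ∉ Function.support f ∪ Function.support (fun k => f (k + 1)) →
      f k = 0 ∧ f (k + 1) = 0 := by
    intro k hk
    simpa using hk
  refine tsum_le_tsum_of_telescope (e := fun k => ε k * ‖f k‖ ^ 2)
    (hf.union (finite_support_shift hf 1)) ?_ ?_ ?_ ?_
  · intro k hk
    simp [(hz k hk).1, (hz k hk).2]
  · intro k hk
    simp [(hz k hk).1]
  · intro k hk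
    simp [(hz k hk).1]
  intro k
  simp only [add_sub_cancel_right]
  rcases lt_trichotomy k (-1) with hk | rfl | hk
  · have h1 : ¬ (0 ≤ k) := by omega
    have h2 : ¬ (0 ≤ k + 1) := by omega
    have hk' : (k : ℝ) + 1 ≤ 0 := by exact_mod_cast (by omega : k + 1 ≤ 0)
    have h := hardy_pointwise (t := -((k : ℝ) + 1)) (by linarith) (f (k + 1)) (f k)
    rw [norm_sub_rev] at h
    simp only [hε, h1, h2, if_false]
    push_cast
    linarith
  · simp [hε]
    linarith
  · have h1 : 0 ≤ k := by omega
    have h2 : 0 ≤ k + 1 := by omega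
    have hk' : (0 : ℝ) ≤ k := by exact_mod_cast h1
    have h := hardy_pointwise (t := (k : ℝ) + 1) (by linarith) (f k) (f (k + 1))
    simp only [hε, h1, h2, if_true]
    push_cast
    linarith

end IntegerSums

/-! ### The cubic graph: weights, Green's formula, weighted Hardy bound and maximum principle. -/

section CubicGraph

/-- The symmetric part of the edge weight between `k` and `k + 1`. -/
def cubicCoeff (k : ℤ) : ℝ := (|(k : ℝ)| ^ 3 + 1) / 2

lemma cubicCoeff_pos (k : ℤ) : 0 < cubicCoeff k := by
  unfold cubicCoeff
  positivity

lemma cubicWeight_succ (x : ℤ) : cubicWeight x (x + 1) = cubicCoeff x + 1 / 4 := by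
  simp [cubicWeight, cubicCoeff]

lemma cubicWeight_pred (x : ℤ) : cubicWeight x (x - 1) = cubicCoeff (x - 1) - 1 / 4 := by
  have : x - 1 ≠ x + 1 := by omega
  simp [cubicWeight, cubicCoeff, this]

lemma cubicWeight_succ_rev (x : ℤ) : cubicWeight (x + 1) x = cubicCoeff x - 1 / 4 := by
  simpa using cubicWeight_pred (x + 1)

lemma cubicWeight_pred_rev (x : ℤ) : cubicWeight (x - 1) x = cubicCoeff (x - 1) + 1 / 4 := by
  simpa using cubicWeight_succ (x - 1)

lemma cubicWeight_eq_zero {x y : ℤ} (h1 : y ≠ x + 1) (h2 : y ≠ x - 1) : cubicWeight x y = 0 := by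
  have : x ≠ y + 1 := by omega
  simp [cubicWeight, h1, this]

lemma tsum_neighbours {M : Type*} [AddCommMonoid M] [TopologicalSpace M] {g : ℤ → M}
    (x : ℤ) (h : ∀ y, y ≠ x + 1 → y ≠ x - 1 → g y = 0) : ∑' y, g y = g (x + 1) + g (x - 1) := by
  have hne : x + 1 ≠ x - 1 := by omega
  rw [tsum_eq_sum (s := {x + 1, x - 1}), Finset.sum_pair hne]
  intro y hy
  simp only [Finset.mem_insert, Finset.mem_singleton, not_or] at hy
  exact h y hy.1 hy.2

lemma cubicGraph_b : cubicGraph.b = cubicWeight := rfl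

lemma cubic_outWeight (x : ℤ) : cubicGraph.outWeight x = cubicCoeff x + cubicCoeff (x - 1) := by
  rw [WeightedDigraph.outWeight, cubicGraph_b,
    tsum_neighbours x fun y h1 h2 => cubicWeight_eq_zero h1 h2, cubicWeight_succ, cubicWeight_pred]
  ring

lemma cubic_inWeight (x : ℤ) : cubicGraph.inWeight x = cubicCoeff x + cubicCoeff (x - 1) := by
  rw [WeightedDigraph.inWeight, cubicGraph_b,
    tsum_neighbours x fun y h1 h2 => cubicWeight_eq_zero (by omega) (by omega),
    cubicWeight_succ_rev, cubicWeight_pred_rev]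
  ring

lemma cubic_assumptionBeta : cubicGraph.AssumptionBeta := fun x => by
  rw [cubic_outWeight, cubic_inWeight]

lemma cubic_assumptionGamma : cubicGraph.AssumptionGamma := by
  refine ⟨1, one_pos, fun x => ?_⟩
  rw [cubicGraph_b, tsum_neighbours x fun y h1 h2 => by
      rw [cubicWeight_eq_zero h1 h2, cubicWeight_eq_zero (by omega) (by omega)]; simp,
    cubicWeight_succ_rev, cubicWeight_pred_rev, cubicWeight_succ, cubicWeight_pred]
  have e1 : cubicCoeff x + 1 / 4 - (cubicCoeff x - 1 / 4) = 1 / 2 := by ring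
  have e2 : cubicCoeff (x - 1) - 1 / 4 - (cubicCoeff (x - 1) + 1 / 4) = -(1 / 2) := by ring
  rw [e1, e2, abs_neg, abs_of_pos (by norm_num)]
  norm_num

lemma cubic_lap_apply (f : ℤ → ℂ) (x : ℤ) : cubicGraph.lap f x =
    (cubicCoeff x + 1 / 4 : ℝ) * (f x - f (x + 1))
      + (cubicCoeff (x - 1) - 1 / 4 : ℝ) * (f x - f (x - 1)) := by
  change ∑' y, (cubicWeight x y : ℂ) * (f x - f y) = _
  rw [tsum_neighbours x fun y h1 h2 => by rw [cubicWeight_eq_zero h1 h2]; simp,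
    cubicWeight_succ, cubicWeight_pred]

lemma cubic_reverse_lap_apply (f : ℤ → ℂ) (x : ℤ) : cubicGraph.reverse.lap f x =
    (cubicCoeff x - 1 / 4 : ℝ) * (f x - f (x + 1))
      + (cubicCoeff (x - 1) + 1 / 4 : ℝ) * (f x - f (x - 1)) := by
  change ∑' y, (cubicWeight y x : ℂ) * (f x - f y) = _
  rw [tsum_neighbours x fun y h1 h2 => by
      rw [cubicWeight_eq_zero (by omega) (by omega)]; simp,
    cubicWeight_succ_rev, cubicWeight_pred_rev]

lemma cubic_symLap_apply (f : ℤ → ℂ) (x : ℤ) : cubicGraph.symLap f x =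
    cubicCoeff x * (f x - f (x + 1)) - cubicCoeff (x - 1) * (f (x - 1) - f x) := by
  change (1 / 2 : ℂ) * (cubicGraph.lap f x + cubicGraph.reverse.lap f x) = _
  rw [cubic_lap_apply, cubic_reverse_lap_apply]
  push_cast
  ring

/-- The antisymmetric parts +1/4 to the right and -1/4 to the left cancel in the coefficient of
f(x), so only a bounded difference of shifts remains. -/
lemma cubic_lap_eq_symLap_add (f : ℤ → ℂ) (x : ℤ) : cubicGraph.lap f x =
    cubicGraph.symLap f x + (1 / 4 : ℂ) * (f (x - 1) - f (x + 1)) := by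
  rw [cubic_lap_apply, cubic_symLap_apply]
  push_cast
  ring

/-- Green's formula. -/
lemma tsum_inner_symLap {u v : ℤ → ℂ}
    (huv : (Function.support u).Finite ∨ (Function.support v).Finite) :
    ∑' k, inner ℂ (u k) (cubicGraph.symLap v k)
      = ∑' k, cubicCoeff k * inner ℂ (u k - u (k + 1)) (v k - v (k + 1)) := by
  set J : ℤ → ℂ := fun k => cubicCoeff k * (v k - v (k + 1)) with hJ
  -- Finite support of either function makes every term of the summation by parts vanish off a
  -- finite set. The other may be arbitrary, as the maximum principle argument requires.
  obtain ⟨s, hs, h⟩ : ∃ s : Set ℤ, s.Finite ∧ ∀ k, k ∉ s →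
      (u k = 0 ∧ u (k + 1) = 0) ∨ (J k = 0 ∧ J (k - 1) = 0) := by
    rcases huv with hu | hv
    · exact ⟨_, hu.union (finite_support_shift hu 1), fun k hk => Or.inl (by simpa using hk)⟩
    · refine ⟨_, (hv.union (finite_support_shift hv 1)).union (finite_support_shift hv (-1)),
        fun k hk => Or.inr ?_⟩
      simp only [Set.mem_union, Function.mem_support, not_or, not_not] at hk
      have h1 : v (k - 1) = 0 := hk.2
      simp [hJ, hk.1.1, hk.1.2, h1]
  have h1 : Summable fun k => inner ℂ (u k) (J k) :=
    summable_of_support_subset hs fun k hk => by rcases h k hk with h | h <;> simp [h]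
  have h2 : Summable fun k => inner ℂ (u (k + 1)) (J k) :=
    summable_of_support_subset hs fun k hk => by rcases h k hk with h | h <;> simp [h]
  have h3 : Summable fun k => inner ℂ (u k) (J (k - 1)) :=
    summable_of_support_subset hs fun k hk => by rcases h k hk with h | h <;> simp [h]
  have e1 : ∀ k, inner ℂ (u k) (cubicGraph.symLap v k)
      = inner ℂ (u k) (J k) - inner ℂ (u k) (J (k - 1)) := fun k => by
    rw [← inner_sub_right, cubic_symLap_apply]
    simp [hJ]
  have e2 : ∀ k, cubicCoeff k * inner ℂ (u k - u (k + 1)) (v k - v (k + 1))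
      = inner ℂ (u k) (J k) - inner ℂ (u (k + 1)) (J k) := fun k => by
    rw [← inner_sub_left, hJ]
    simp only [RCLike.inner_apply]
    ring
  simp_rw [e1, e2]
  rw [h1.tsum_sub h3, h1.tsum_sub h2, ← tsum_shift (fun k => inner ℂ (u k) (J (k - 1))) 1]
  simp

lemma conj_tsum_inner_symLap {u v : ℤ → ℂ}
    (huv : (Function.support u).Finite ∨ (Function.support v).Finite) :
    (starRingEnd ℂ) (∑' k, inner ℂ (v k) (cubicGraph.symLap u k))
      = ∑' k, inner ℂ (u k) (cubicGraph.symLap v k) := by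
  rw [tsum_inner_symLap huv.symm, tsum_inner_symLap huv, Complex.conj_tsum]
  refine tsum_congr fun k => ?_
  rw [map_mul, Complex.conj_ofReal, inner_conj_symm]

/-- The form of `H` controls the growing weight `(3|k| - 2)/8`. -/
lemma tsum_weight_le_form {u : ℤ → ℂ} (hu : (Function.support u).Finite) :
    ∑' k : ℤ, (3 / 8 * |(k : ℝ)| - 1 / 4) * ‖u k‖ ^ 2
      ≤ (∑' k, inner ℂ (u k) (cubicGraph.symLap u k)).re := by
  have hus : ∀ k, k ∉ Function.support u ∪ Function.support (fun k => u (k + 1)) →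
      u k = 0 ∧ u (k + 1) = 0 := fun k hk => by simpa using hk
  have e1 : ∀ k, (cubicCoeff k : ℂ) * inner ℂ (u k - u (k + 1)) (u k - u (k + 1))
      = ((cubicCoeff k * ‖u k - u (k + 1)‖ ^ 2 : ℝ) : ℂ) := fun k => by
    rw [inner_self_eq_norm_sq_to_K]
    push_cast
    rfl
  rw [tsum_inner_symLap (Or.inl hu)]
  simp_rw [e1]
  rw [← Complex.ofReal_tsum, Complex.ofReal_re]
  -- Chosen with t = |k| and half the cubic inequality. For k ≥ 0, k²/4 - k/8 - (k-1)²/4 = 3k/8 -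
  -- 1/4 is the claimed weight; for k ≤ -2 the endpoints are exchanged and 3/8 is left over. At k =
  -- -1 the left side is nonpositive.
  set ε : ℤ → ℝ := fun k => if 0 ≤ k then ((k : ℝ) - 1) ^ 2 / 4
    else -(k : ℝ) ^ 2 / 4 + 3 * ((k : ℝ) - 1) / 8 + 1 / 4 with hε
  refine tsum_le_tsum_of_telescope (e := fun k => ε k * ‖u k‖ ^ 2)
    (hu.union (finite_support_shift hu 1)) ?_ ?_ ?_ ?_
  · intro k hk
    simp [hus k hk]
  · intro k hk
    simp [hus k hk]
  · intro k hk
    simp [hus k hk]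
  intro k
  have hsq := sq_nonneg ‖u k‖
  have hsq' := sq_nonneg ‖u (k + 1)‖
  have hD := sq_nonneg ‖u k - u (k + 1)‖
  unfold cubicCoeff
  rcases lt_trichotomy k (-1) with hk | rfl | hk
  · have h1 : ¬ (0 ≤ k) := by omega
    have h2 : ¬ (0 ≤ k + 1) := by omega
    have hk' : (k : ℝ) ≤ 0 := by exact_mod_cast (by omega : k ≤ 0)
    have h := cubic_hardy_pointwise (t := -(k : ℝ)) (by linarith) (u (k + 1)) (u k)
    rw [norm_sub_rev] at h
    simp only [hε, h1, h2, if_false, abs_of_nonpos hk']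
    push_cast
    nlinarith
  · have h := cubic_hardy_pointwise (t := 1) (by norm_num) (u (-1 + 1)) (u (-1))
    rw [norm_sub_rev] at h
    norm_num [hε] at h ⊢
    nlinarith [sq_nonneg ‖u (-1)‖, sq_nonneg ‖u 0‖, sq_nonneg ‖u (-1) - u 0‖]
  · have h1 : 0 ≤ k := by omega
    have h2 : 0 ≤ k + 1 := by omega
    have hk' : (0 : ℝ) ≤ k := by exact_mod_cast h1
    have h := cubic_hardy_pointwise hk' (u k) (u (k + 1))
    simp only [hε, h1, h2, if_true, abs_of_nonneg hk']
    push_cast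
    nlinarith

lemma form_nonneg {u : ℤ → ℂ} (hu : (Function.support u).Finite) :
    0 ≤ (∑' k, inner ℂ (u k) (cubicGraph.symLap u k)).re := by
  have e1 : ∀ k, (cubicCoeff k : ℂ) * inner ℂ (u k - u (k + 1)) (u k - u (k + 1))
      = ((cubicCoeff k * ‖u k - u (k + 1)‖ ^ 2 : ℝ) : ℂ) := fun k => by
    rw [inner_self_eq_norm_sq_to_K]
    push_cast
    rfl
  rw [tsum_inner_symLap (Or.inl hu)]
  simp_rw [e1]
  rw [← Complex.ofReal_tsum, Complex.ofReal_re]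
  exact tsum_nonneg fun k => mul_nonneg (cubicCoeff_pos k).le (sq_nonneg _)

/-- A function vanishing at infinity with `H u = -u` wherever it does not vanish is zero. -/
lemma eq_zero_of_symLap_eq_neg {u : ℤ → ℂ} (hu : Tendsto u cofinite (𝓝 0))
    (h : ∀ k, u k ≠ 0 → cubicGraph.symLap u k = -u k) : u = 0 := by
  by_contra hne
  obtain ⟨k₀, hk₀⟩ := Function.ne_iff.1 hne
  have hpos : 0 < ‖u k₀‖ := norm_pos_iff.2 hk₀
  have hfin : {k | ‖u k₀‖ ≤ ‖u k‖}.Finite := by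
    have h1 : ∀ᶠ k in cofinite, ‖u k‖ < ‖u k₀‖ :=
      hu.norm.eventually (gt_mem_nhds (by simpa using hpos))
    simpa only [not_lt] using Filter.eventually_cofinite.1 h1
  obtain ⟨m, hm, hmax⟩ := hfin.exists_maximalFor (fun k => ‖u k‖) _ ⟨k₀, le_refl ‖u k₀‖⟩
  have hle : ∀ k, ‖u k‖ ≤ ‖u m‖ := by
    intro k
    by_contra! hlt
    exact absurd (hmax (j := k) (le_trans hm hlt.le) hlt.le) (not_le.2 hlt)
  have hmpos : 0 < ‖u m‖ := hpos.trans_le hm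
  have hm0 : u m ≠ 0 := norm_pos_iff.1 hmpos
  -- Only u(m) ≠ 0 is needed here, so Dirichlet extensions by zero are covered. At the maximum, (c +
  -- c' + 1)|u(m)| ≤ (c + c')|u(m)| is impossible.
  have heq := h m hm0
  rw [cubic_symLap_apply] at heq
  have heq' : ((cubicCoeff m + cubicCoeff (m - 1) + 1 : ℝ) : ℂ) * u m
      = cubicCoeff m * u (m + 1) + cubicCoeff (m - 1) * u (m - 1) := by
    push_cast
    linear_combination heq
  have hA := cubicCoeff_pos m
  have hB := cubicCoeff_pos (m - 1)
  have hn := congrArg norm heq'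
  rw [norm_mul, Complex.norm_real, Real.norm_of_nonneg (by positivity)] at hn
  have h2 := norm_add_le ((cubicCoeff m : ℂ) * u (m + 1)) (cubicCoeff (m - 1) * u (m - 1))
  rw [norm_mul, norm_mul, Complex.norm_real, Complex.norm_real, Real.norm_of_nonneg hA.le,
    Real.norm_of_nonneg hB.le] at h2
  nlinarith [hle (m + 1), hle (m - 1)]

end CubicGraph

/-! ### The space ℓ²: extension by zero, shifts and compactness from moments. -/

section EllTwo

lemma norm_sq_eq_tsum {X : Type*} (f : EllTwo X) : ‖f‖ ^ 2 = ∑' x, ‖f x‖ ^ 2 := by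
  simpa using lp.norm_rpow_eq_tsum (p := 2) (by norm_num) f

lemma summable_norm_sq {X : Type*} (f : EllTwo X) : Summable fun x => ‖f x‖ ^ 2 := by
  simpa using (lp.memℓp f).summable (p := 2) (by norm_num)

lemma dense_finSupp (X : Type*) : Dense (finSupp X : Set (EllTwo X)) := by
  classical
  intro f
  refine mem_closure_of_tendsto (lp.hasSum_single (p := 2) (by norm_num) f)
    (Eventually.of_forall fun s => ?_)
  refine Submodule.sum_mem _ fun x _ => ?_
  refine (Set.finite_singleton x).subset fun y hy => ?_
  by_contra hne
  exact hy (lp.single_apply_ne _ _ _ hne)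

lemma tsum_comp_of_injective {X M : Type*} [AddCommMonoid M] [TopologicalSpace M] {ι : X → ℤ}
    (hι : Function.Injective ι) {g : ℤ → M} (hg : ∀ k, k ∉ Set.range ι → g k = 0) :
    ∑' x, g (ι x) = ∑' k, g k :=
  hι.tsum_eq fun k hk => by
    by_contra h
    exact hk (hg k h)

lemma extend_of_notMem_range {X : Type*} {ι : X → ℤ} (f : X → ℂ) {k : ℤ} (hk : k ∉ Set.range ι) :
    Function.extend ι f 0 k = 0 :=
  Function.extend_apply' f (0 : ℤ → ℂ) k hk

lemma inner_eq_tsum_extend {X : Type*} {ι : X → ℤ} (hι : Function.Injective ι) (f g : EllTwo X)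
    (G : ℤ → ℂ) (hG : ∀ x, g x = G (ι x)) :
    inner ℂ f g = ∑' k, inner ℂ (Function.extend ι (f : X → ℂ) 0 k) (G k) := by
  rw [lp.inner_eq_tsum, ← tsum_comp_of_injective hι fun k hk => by
    rw [extend_of_notMem_range _ hk, inner_zero_left]]
  exact tsum_congr fun x => by rw [hι.extend_apply, hG]

lemma finite_support_extend {X : Type*} {ι : X → ℤ} (hι : Function.Injective ι) {f : X → ℂ}
    (hf : (Function.support f).Finite) : (Function.support (Function.extend ι f 0)).Finite := by
  refine (hf.image ι).subset fun k hk => ?_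
  by_cases h : k ∈ Set.range ι
  · obtain ⟨x, rfl⟩ := h
    exact ⟨x, by simpa [hι.extend_apply] using hk, rfl⟩
  · exact absurd (extend_of_notMem_range f h) hk

lemma tendsto_extend_cofinite {X : Type*} {ι : X → ℤ} (hι : Function.Injective ι) (f : EllTwo X) :
    Tendsto (Function.extend ι (f : X → ℂ) 0) cofinite (𝓝 0) := by
  have h1 : Summable fun k => ‖Function.extend ι (f : X → ℂ) 0 k‖ ^ 2 := by
    rw [← hι.summable_iff fun k hk => by rw [extend_of_notMem_range _ hk]; simp]
    refine (summable_norm_sq f).congr fun x => ?_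
    simp [hι.extend_apply]
  have h2 := h1.tendsto_cofinite_zero.sqrt
  simp only [Real.sqrt_zero, Real.sqrt_sq (norm_nonneg _)] at h2
  exact tendsto_zero_iff_norm_tendsto_zero.2 h2

/-- The shift operator on `ℓ²(ℤ)`. -/
def shiftEllTwo (c : ℤ) : EllTwo ℤ →L[ℂ] EllTwo ℤ :=
  LinearMap.mkContinuous
    { toFun := fun f => ⟨fun k => f (k + c), by
        refine memℓp_gen ?_
        simpa [Function.comp_def] using (Equiv.addRight c).summable_iff.2 (summable_norm_sq f)⟩
      map_add' := fun f g => by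
        ext k
        rfl
      map_smul' := fun a f => by
        ext k
        rfl } 1 fun f => by
    rw [one_mul]
    refine le_of_sq_le_sq ?_ (norm_nonneg _)
    rw [norm_sq_eq_tsum, norm_sq_eq_tsum]
    exact (tsum_shift (fun k => ‖f k‖ ^ 2) c).le

lemma shiftEllTwo_apply (c : ℤ) (f : EllTwo ℤ) (k : ℤ) : shiftEllTwo c f k = f (k + c) := rfl

lemma inner_shiftEllTwo (c : ℤ) (f g : EllTwo ℤ) :
    inner ℂ (shiftEllTwo c f) g = inner ℂ f (shiftEllTwo (-c) g) := by
  rw [lp.inner_eq_tsum, lp.inner_eq_tsum,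
    ← tsum_shift (fun k => inner ℂ (f k) (shiftEllTwo (-c) g k)) c]
  refine tsum_congr fun k => ?_
  simp [shiftEllTwo_apply]

/-- The bounded skew-adjoint part of the Laplacian of the cubic graph. -/
def skewPart : EllTwo ℤ →L[ℂ] EllTwo ℤ := (1 / 4 : ℂ) • (shiftEllTwo (-1) - shiftEllTwo 1)

lemma inner_skewPart (f g : EllTwo ℤ) : inner ℂ (skewPart f) g = -inner ℂ f (skewPart g) := by
  have h : (starRingEnd ℂ) (1 / 4 : ℂ) = 1 / 4 := by
    rw [show (1 / 4 : ℂ) = ((1 / 4 : ℝ) : ℂ) by push_cast; rfl, Complex.conj_ofReal]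
  simp only [skewPart, smul_apply, sub_apply, inner_smul_left, inner_smul_right, inner_sub_left,
    inner_sub_right, inner_shiftEllTwo, h, neg_neg]
  ring

/-- Bounded sets of functions with uniformly bounded moments are totally bounded. -/
lemma totallyBounded_of_moment (C : ℝ) :
    TotallyBounded {u : EllTwo ℤ | ‖u‖ ≤ C ∧
      ∀ s : Finset ℤ, ∑ k ∈ s, |(k : ℝ)| * ‖u k‖ ^ 2 ≤ C} := by
  classical
  rw [Metric.totallyBounded_iff]
  intro ε hε
  -- With this N the moment bound makes the tail over |k| > N have norm at most ε/4; the rest is a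
  -- bounded set in finite dimension.
  obtain ⟨N, hN⟩ := exists_nat_gt (C / (ε / 2 / 2) ^ 2)
  rw [div_lt_iff₀ (by positivity)] at hN
  set s : Finset ℤ := Finset.Icc (-(N : ℤ)) N with hs
  let Φ : (s → ℂ) → EllTwo ℤ := fun c => ∑ k : s, lp.single 2 (k : ℤ) (c k)
  have hΦ : Continuous Φ := by
    refine continuous_finsetSum _ fun k _ => ?_
    exact ((lp.isometry_single (E := fun _ : ℤ => ℂ) (p := 2) (k : ℤ)).continuous).comp
      (continuous_apply k)
  have hcomp : IsCompact (Φ '' Metric.closedBall 0 C) :=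
    (isCompact_closedBall _ _).image hΦ
  obtain ⟨t, ht, hcov⟩ := Metric.totallyBounded_iff.1 hcomp.totallyBounded (ε / 2) (by positivity)
  refine ⟨t, ht, ?_⟩
  rintro u ⟨hu, hmom⟩
  have hC : 0 ≤ C := (norm_nonneg u).trans hu
  have hΦu : Φ (fun k => u k) ∈ Φ '' Metric.closedBall 0 C := by
    refine Set.mem_image_of_mem _ ?_
    rw [mem_closedBall_zero_iff, pi_norm_le_iff_of_nonneg hC]
    exact fun k => (lp.norm_apply_le_norm (by norm_num) u k).trans hu
  obtain ⟨y, hy, hyd⟩ := Set.mem_iUnion₂.1 (hcov hΦu)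
  refine Set.mem_iUnion₂.2 ⟨y, hy, ?_⟩
  rw [Metric.mem_ball] at hyd ⊢
  have hval : ∀ k, (Φ (fun k => u k)) k = if k ∈ s then u k else 0 := by
    intro k
    simp only [Φ]
    rw [lp.coeFn_sum, Finset.sum_apply, Finset.sum_coe_sort s (fun j => lp.single 2 j (u j) k)]
    simp [Pi.single_apply]
  have htail : dist u (Φ fun k => u k) ≤ ε / 2 / 2 := by
    rw [dist_eq_norm]
    refine lp.norm_le_of_forall_sum_le (by norm_num) (by positivity) fun r => ?_
    simp only [ENNReal.toReal_ofNat, Real.rpow_ofNat]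
    have hterm : ∀ k ∈ r, (N : ℝ) * ‖(u - Φ fun k => u k) k‖ ^ 2 ≤ |(k : ℝ)| * ‖u k‖ ^ 2 := by
      intro k _
      rw [lp.coeFn_sub, Pi.sub_apply, hval]
      split_ifs with hk
      · rw [sub_self, norm_zero, zero_pow two_ne_zero, mul_zero]
        positivity
      · rw [sub_zero]
        refine mul_le_mul_of_nonneg_right ?_ (sq_nonneg _)
        have : (N : ℤ) ≤ |k| := by
          by_contra! hlt
          exact hk (Finset.mem_Icc.2 (abs_le.1 hlt.le))
        exact_mod_cast this
    have h1 := (Finset.sum_le_sum hterm).trans (hmom r)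
    rw [← Finset.mul_sum] at h1
    have hNpos : (0 : ℝ) < N := by
      by_contra! h
      nlinarith [sq_nonneg (ε / 2 / 2)]
    exact le_of_mul_le_mul_left (h1.trans hN.le) hNpos
  calc dist u y ≤ dist u (Φ fun k => u k) + dist (Φ fun k => u k) y := dist_triangle _ _ _
    _ < ε := by linarith

end EllTwo

/-! ### Compressions of `H` along an injection into ℤ, covering `H` itself and the Dirichlet
operators. -/

section SymmetricOperators

variable {X : Type*} {ι : X → ℤ} {A : EllTwo X →ₗ.[ℂ] EllTwo X}

lemma inner_form_eq (hι : Function.Injective ι)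
    (hA : ∀ (f : A.domain) (x : X),
      A f x = cubicGraph.symLap (Function.extend ι ((f : EllTwo X) : X → ℂ) 0) (ι x))
    (v : EllTwo X) (f : A.domain) :
    inner ℂ v (A f) = ∑' k, inner ℂ (Function.extend ι (v : X → ℂ) 0 k)
      (cubicGraph.symLap (Function.extend ι ((f : EllTwo X) : X → ℂ) 0) k) :=
  inner_eq_tsum_extend hι v (A f) _ (hA f)

/-- The compressions of `H` to subsets of `ℤ` are essentially self-adjoint. -/
lemma essentiallySelfAdjoint_of_symLap (hι : Function.Injective ι) (hdom : A.domain = finSupp X)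
    (hA : ∀ (f : A.domain) (x : X),
      A f x = cubicGraph.symLap (Function.extend ι ((f : EllTwo X) : X → ℂ) 0) (ι x)) :
    EssentiallySelfAdjoint A := by
  classical
  have hfin : ∀ f : A.domain,
      (Function.support (Function.extend ι ((f : EllTwo X) : X → ℂ) 0)).Finite :=
    fun f => finite_support_extend hι (hdom.le f.2)
  refine essentiallySelfAdjoint_of_dense_range (by rw [hdom]; exact dense_finSupp X) ?_ ?_ ?_
  · intro f g
    rw [← inner_conj_symm, inner_form_eq hι hA, inner_form_eq hι hA,
      conj_tsum_inner_symLap (Or.inl (hfin f))]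
  · intro f
    rw [inner_form_eq hι hA]
    exact form_nonneg (hfin f)
  · intro v hv
    set V := Function.extend ι (v : X → ℂ) 0 with hV
    have hzero : V = 0 := by
      refine eq_zero_of_symLap_eq_neg (tendsto_extend_cofinite hι v) ?_
      intro k hk
      obtain ⟨x, rfl⟩ : k ∈ Set.range ι := by
        by_contra h
        exact hk (extend_of_notMem_range _ h)
      have hmem : lp.single 2 x (1 : ℂ) ∈ A.domain := by
        refine hdom.ge ((Set.finite_singleton x).subset fun y hy => ?_)
        by_contra hne
        exact hy (lp.single_apply_ne _ _ _ hne)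
      set f : A.domain := ⟨lp.single 2 x (1 : ℂ), hmem⟩ with hf
      have h1 := hv f
      have hF : Function.extend ι ((f : EllTwo X) : X → ℂ) 0 = Pi.single (ι x) 1 := by
        ext k
        by_cases hk : k ∈ Set.range ι
        · obtain ⟨y, rfl⟩ := hk
          rw [hι.extend_apply]
          simp [hf, Pi.single_apply, hι.eq_iff]
        · rw [extend_of_notMem_range _ hk, Pi.single_eq_of_ne]
          rintro rfl
          exact hk ⟨x, rfl⟩
      -- Testing orthogonality against the delta function at x and moving `H` onto V by Green's
      -- formula gives the pointwise equation at ι x.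
      rw [inner_add_right, inner_form_eq hι hA, ← hV,
        ← conj_tsum_inner_symLap (Or.inr (hfin f)), hF, tsum_eq_single (ι x)
          (fun k hk => by rw [Pi.single_eq_of_ne hk, inner_zero_left]),
        Pi.single_eq_same, lp.inner_single_right] at h1
      have h2 := congrArg (starRingEnd ℂ) h1
      rw [map_add, Complex.conj_conj, inner_conj_symm] at h2
      simp only [RCLike.inner_apply, map_one, mul_one, map_zero] at h2
      rw [hV, hι.extend_apply]
      linear_combination h2
    ext x
    have := congrFun hzero (ι x)
    rwa [hV, hι.extend_apply] at this

lemma weight_le_form (hι : Function.Injective ι) (hdom : A.domain = finSupp X)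
    (hA : ∀ (f : A.domain) (x : X),
      A f x = cubicGraph.symLap (Function.extend ι ((f : EllTwo X) : X → ℂ) 0) (ι x))
    (f : A.domain) :
    ∑' x, (3 / 8 * |(ι x : ℝ)| - 1 / 4) * ‖(f : EllTwo X) x‖ ^ 2
      ≤ (inner ℂ (f : EllTwo X) (A f)).re := by
  rw [inner_form_eq hι hA]
  refine le_of_eq_of_le ?_ (tsum_weight_le_form (finite_support_extend hι (hdom.le f.2)))
  rw [← tsum_comp_of_injective hι fun k hk => by rw [extend_of_notMem_range _ hk]; simp]
  exact tsum_congr fun x => by rw [hι.extend_apply]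

lemma form_bound_of_le (hι : Function.Injective ι) (hdom : A.domain = finSupp X)
    (hA : ∀ (f : A.domain) (x : X),
      A f x = cubicGraph.symLap (Function.extend ι ((f : EllTwo X) : X → ℂ) 0) (ι x))
    {m : ℝ} (hm : ∀ x, m ≤ 3 / 8 * |(ι x : ℝ)| - 1 / 4) (f : A.domain) :
    m * ‖(f : EllTwo X)‖ ^ 2 ≤ (inner ℂ (f : EllTwo X) (A f)).re := by
  refine le_trans ?_ (weight_le_form hι hdom hA f)
  have hf : (Function.support ((f : EllTwo X) : X → ℂ)).Finite := hdom.le f.2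
  rw [norm_sq_eq_tsum, ← tsum_mul_left]
  refine ((summable_norm_sq _).mul_left m).tsum_le_tsum
    (fun x => mul_le_mul_of_nonneg_right (hm x) (sq_nonneg _)) ?_
  refine summable_of_hasFiniteSupport (hf.subset fun x hx => ?_)
  by_contra h
  exact hx (by simp [Function.notMem_support.1 h])

end SymmetricOperators

/-! ### The operators H̄, S and the closure of Δ on ℓ²(ℤ). -/

section Laplacian

lemma extend_id (f : ℤ → ℂ) : Function.extend id f 0 = f :=
  funext fun x => Function.injective_id.extend_apply f 0 x

lemma cubic_H_apply (f : cubicGraph.H.domain) (x : ℤ) :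
    cubicGraph.H f x
      = cubicGraph.symLap (Function.extend id ((f : EllTwo ℤ) : ℤ → ℂ) 0) (id x) := by
  rw [extend_id]
  rfl

lemma cubic_H_essentiallySelfAdjoint : EssentiallySelfAdjoint cubicGraph.H :=
  essentiallySelfAdjoint_of_symLap Function.injective_id rfl cubic_H_apply

lemma cubic_Delta_eq (f : cubicGraph.Delta.domain) (g : cubicGraph.H.domain)
    (h : (f : EllTwo ℤ) = g) : cubicGraph.Delta f = cubicGraph.H g + skewPart g := by
  obtain rfl : f = g := Subtype.ext h
  ext x
  exact cubic_lap_eq_symLap_add _ x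

lemma cubic_S_eq : cubicGraph.S = cubicGraph.H.closure :=
  half_closure_add_adjoint (A := cubicGraph.H) (B := cubicGraph.Delta) rfl cubic_Delta_eq
    (dense_finSupp ℤ) cubic_H_essentiallySelfAdjoint inner_skewPart

/-- Finite partial sums are continuous on ℓ², unlike the full moment, so the bound is a closed
condition and extends from `H` to its closure. The constants come from solving the weighted Hardy
bound for the moment. -/
lemma cubic_moment_bound (f : cubicGraph.H.closure.domain) (s : Finset ℤ) :
    ∑ k ∈ s, |(k : ℝ)| * ‖(f : EllTwo ℤ) k‖ ^ 2
      ≤ 8 / 3 * (inner ℂ (f : EllTwo ℤ) (cubicGraph.H.closure f)).re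
        + 2 / 3 * ‖(f : EllTwo ℤ)‖ ^ 2 := by
  refine closure_induction cubic_H_essentiallySelfAdjoint.1
    (P := fun x y => ∑ k ∈ s, |(k : ℝ)| * ‖x k‖ ^ 2
      ≤ 8 / 3 * (inner ℂ x y).re + 2 / 3 * ‖x‖ ^ 2) ?_ ?_ f
  · have hev : ∀ k : ℤ, Continuous fun p : EllTwo ℤ × EllTwo ℤ => p.1 k := fun k =>
      (lp.evalCLM ℂ (fun _ : ℤ => ℂ) 2 k).continuous.comp continuous_fst
    refine isClosed_le (continuous_finsetSum _ fun k _ => ?_) (Continuous.add ?_ (by fun_prop))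
    · exact continuous_const.mul ((hev k).norm.pow 2)
    · exact continuous_const.mul
        (Complex.continuous_re.comp (continuous_fst.inner continuous_snd))
  · intro f
    have h := weight_le_form Function.injective_id rfl cubic_H_apply f
    have hf : (Function.support ((f : EllTwo ℤ) : ℤ → ℂ)).Finite := f.2
    have hS : Summable fun k : ℤ => |(k : ℝ)| * ‖(f : EllTwo ℤ) k‖ ^ 2 :=
      summable_of_support_subset hf fun k hk => by simp [Function.notMem_support.1 hk]
    have hle := hS.sum_le_tsum s fun k _ => by positivity
    have e1 : ∑' k : ℤ, (3 / 8 * |((id k : ℤ) : ℝ)| - 1 / 4) * ‖(f : EllTwo ℤ) k‖ ^ 2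
        = 3 / 8 * ∑' k : ℤ, |(k : ℝ)| * ‖(f : EllTwo ℤ) k‖ ^ 2
          - 1 / 4 * ‖(f : EllTwo ℤ)‖ ^ 2 := by
      rw [norm_sq_eq_tsum, ← tsum_mul_left, ← tsum_mul_left,
        ← (hS.mul_left _).tsum_sub ((summable_norm_sq _).mul_left _)]
      exact tsum_congr fun k => by simp only [id]; ring
    rw [e1] at h
    linarith

lemma cubic_compact_domain (C : ℝ) : ∃ K : Set (EllTwo ℤ), IsCompact K ∧
    ∀ u : cubicGraph.H.closure.domain, ‖(u : EllTwo ℤ)‖ ≤ C → ‖cubicGraph.H.closure u‖ ≤ C →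
      (u : EllTwo ℤ) ∈ K := by
  -- Bounds C on u and H̄u give moments at most (8/3 + 2/3)C²; the maximum with C supplies the
  -- single constant of `totallyBounded_of_moment`.
  refine ⟨closure {u : EllTwo ℤ | ‖u‖ ≤ max C (10 / 3 * C ^ 2) ∧
      ∀ s : Finset ℤ, ∑ k ∈ s, |(k : ℝ)| * ‖u k‖ ^ 2 ≤ max C (10 / 3 * C ^ 2)},
    (totallyBounded_of_moment _).closure.isCompact_of_isClosed isClosed_closure,
    fun u hu hHu => subset_closure ⟨hu.trans (le_max_left _ _), fun s => ?_⟩⟩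
  refine (cubic_moment_bound u s).trans (le_trans ?_ (le_max_right _ _))
  have hC : 0 ≤ C := (norm_nonneg _).trans hu
  have h1 : (inner ℂ (u : EllTwo ℤ) (cubicGraph.H.closure u)).re ≤ C * C :=
    (Complex.re_le_norm _).trans ((norm_inner_le_norm _ _).trans
      (mul_le_mul hu hHu (norm_nonneg _) hC))
  have h2 : ‖(u : EllTwo ℤ)‖ ^ 2 ≤ C ^ 2 := pow_le_pow_left₀ (norm_nonneg _) hu 2
  nlinarith

lemma cubic_essSpectrum_S : essSpectrum cubicGraph.S = ∅ := by
  rw [cubic_S_eq]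
  exact essSpectrum_eq_empty_of_compact cubic_H_essentiallySelfAdjoint.1.closure_isClosed
    cubic_compact_domain

lemma cubic_closure_Delta : cubicGraph.Delta.IsClosable ∧
    cubicGraph.Delta.closure.domain = cubicGraph.H.closure.domain ∧
      ∀ (f : cubicGraph.Delta.closure.domain) (g : cubicGraph.H.closure.domain),
        (f : EllTwo ℤ) = g →
          cubicGraph.Delta.closure f = cubicGraph.H.closure g + skewPart g :=
  closure_of_perturbation rfl cubic_Delta_eq cubic_H_essentiallySelfAdjoint.1

lemma cubic_essSpectrum_Delta : essSpectrum cubicGraph.Delta.closure = ∅ := by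
  obtain ⟨hcl, hdom, hD⟩ := cubic_closure_Delta
  refine essSpectrum_eq_empty_of_compact hcl.closure_isClosed fun C => ?_
  -- Passing from the closure of Δ to H̄ costs at most ‖`skewPart`‖C in norm.
  obtain ⟨K, hK, hmem⟩ := cubic_compact_domain (C + ‖skewPart‖ * C)
  refine ⟨K, hK, fun u hu hDu => hmem ⟨u, hdom.le u.2⟩ ?_ ?_⟩
  · have hC : 0 ≤ C := (norm_nonneg _).trans hu
    exact hu.trans (le_add_of_nonneg_right (by positivity))
  · have h := hD u ⟨u, hdom.le u.2⟩ rfl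
    rw [← sub_eq_iff_eq_add] at h
    rw [← h]
    refine (norm_sub_le _ _).trans (add_le_add hDu ?_)
    exact (skewPart.le_opNorm _).trans (mul_le_mul_of_nonneg_left hu (norm_nonneg _))

end Laplacian

/-! ### Dirichlet operators outside V_n and the bottom of their spectrum. -/

section Dirichlet

lemma cubic_HDirichlet_apply (Ω : Set ℤ) (f : (cubicGraph.HDirichlet Ω).domain) (x : Ω) :
    cubicGraph.HDirichlet Ω f x = cubicGraph.symLap
      (Function.extend Subtype.val ((f : EllTwo Ω) : Ω → ℂ) 0) (x : ℤ) := rfl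

lemma cubic_HDirichlet_essentiallySelfAdjoint (Ω : Set ℤ) :
    EssentiallySelfAdjoint (cubicGraph.HDirichlet Ω) :=
  essentiallySelfAdjoint_of_symLap Subtype.val_injective rfl (cubic_HDirichlet_apply Ω)

lemma cubic_HDirichlet_form_bound (n : ℕ) (f : (cubicGraph.HDirichlet (ballZ n)ᶜ).domain) :
    (n : ℝ) / 8 * ‖(f : EllTwo ↥(ballZ n)ᶜ)‖ ^ 2
      ≤ (inner ℂ (f : EllTwo ↥(ballZ n)ᶜ) (cubicGraph.HDirichlet (ballZ n)ᶜ f)).re := by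
  refine form_bound_of_le Subtype.val_injective rfl (cubic_HDirichlet_apply _) (fun x => ?_) f
  -- Off V_n the Hardy weight is at least 3(n + 1)/8 - 1/4 = (3n + 1)/8.
  have h1 : (n : ℤ) + 1 ≤ |(x : ℤ)| := by
    by_contra! hlt
    exact x.2 (abs_le.1 (by omega : |(x : ℤ)| ≤ n))
  have h2 : (n : ℝ) + 1 ≤ |((x : ℤ) : ℝ)| := by exact_mod_cast h1
  have h3 : (0 : ℝ) ≤ n := n.cast_nonneg
  linarith

lemma exists_unit_finSupp {X : Type*} (x : X) : ∃ f : finSupp X, ‖(f : EllTwo X)‖ = 1 := by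
  classical
  refine ⟨⟨lp.single 2 x (1 : ℂ), (Set.finite_singleton x).subset fun y hy => ?_⟩, ?_⟩
  · by_contra hne
    exact hy (lp.single_apply_ne _ _ _ hne)
  · simp

lemma exists_unit_HDirichlet (n : ℕ) :
    ∃ f : (cubicGraph.HDirichlet (ballZ n)ᶜ).domain, ‖(f : EllTwo ↥(ballZ n)ᶜ)‖ = 1 :=
  exists_unit_finSupp ⟨(n : ℤ) + 1, fun h => by have := h.2; omega⟩

lemma cubic_lambdaOne_eq (n : ℕ) : lambdaOne (cubicGraph.SDirichlet (ballZ n)ᶜ)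
    = rayleighInf (cubicGraph.HDirichlet (ballZ n)ᶜ) := by
  refine lambdaOne_closure_eq_rayleighInf (cubic_HDirichlet_essentiallySelfAdjoint _)
    (cubic_HDirichlet_form_bound n) ?_
  obtain ⟨f, hf⟩ := exists_unit_HDirichlet n
  refine ⟨f, ?_⟩
  rintro rfl
  simp at hf

lemma cubic_lambdaOne_ge (n : ℕ) :
    (n : ℝ) / 8 ≤ lambdaOne (cubicGraph.SDirichlet (ballZ n)ᶜ) := by
  rw [cubic_lambdaOne_eq]
  obtain ⟨f, hf⟩ := exists_unit_HDirichlet n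
  refine le_csInf ⟨_, f, hf, rfl⟩ ?_
  rintro _ ⟨g, hg, rfl⟩
  simpa [hg] using cubic_HDirichlet_form_bound n g

end Dirichlet

/-! ### Vanishing of the Cheeger constant at infinity. -/

section Cheeger

lemma cubicCoeff_le {N : ℕ} (hN : 1 ≤ N) {k : ℤ} (h0 : 0 ≤ k) (hk : k ≤ 2 * N) :
    cubicCoeff k + 1 / 4 ≤ 5 * (N : ℝ) ^ 3 := by
  have h0' : (0 : ℝ) ≤ k := by exact_mod_cast h0
  have hk' : (k : ℝ) ≤ 2 * N := by exact_mod_cast hk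
  have h1 : (1 : ℝ) ≤ (N : ℝ) ^ 3 := one_le_pow₀ (by exact_mod_cast hN)
  have h2 : (k : ℝ) ^ 3 ≤ (2 * N) ^ 3 := pow_le_pow_left₀ h0' hk' 3
  rw [cubicCoeff, abs_of_nonneg h0']
  linarith [mul_pow (2 : ℝ) N 3]

lemma cubic_edgeBoundary_le {N : ℕ} (hN : 1 ≤ N) :
    ∑' e : cubicGraph.edgeBoundary (Finset.Icc ((N : ℤ) + 1) (2 * N) : Finset ℤ),
      cubicGraph.b e.1.1 e.1.2 ≤ 20 * (N : ℝ) ^ 3 := by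
  classical
  set U : Finset ℤ := Finset.Icc ((N : ℤ) + 1) (2 * N) with hU
  -- An interval is joined to its complement only at its two ends, by one edge in each direction.
  set T : Finset (ℤ × ℤ) := {((N : ℤ), (N : ℤ) + 1), ((N : ℤ) + 1, (N : ℤ)),
    (2 * (N : ℤ), 2 * (N : ℤ) + 1), (2 * (N : ℤ) + 1, 2 * (N : ℤ))} with hT
  have hsub : ∀ e ∉ T, (cubicGraph.edgeBoundary (U : Set ℤ)).indicator
      (fun e : ℤ × ℤ => cubicGraph.b e.1 e.2) e = 0 := by
    rintro ⟨x, y⟩ he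
    refine Set.indicator_of_notMem ?_ _
    rintro ⟨hb, hxy⟩
    refine he ?_
    have hnb : y = x + 1 ∨ y = x - 1 := by
      by_contra! h
      exact hb.ne' (cubicWeight_eq_zero h.1 h.2)
    simp only [hU, Finset.coe_Icc, Set.mem_Icc] at hxy
    simp only [hT, Finset.mem_insert, Finset.mem_singleton, Prod.mk.injEq]
    omega
  rw [tsum_subtype (cubicGraph.edgeBoundary (U : Set ℤ))
    (fun e : ℤ × ℤ => cubicGraph.b e.1 e.2), tsum_eq_sum hsub]
  have hterm : ∀ e ∈ T, (cubicGraph.edgeBoundary (U : Set ℤ)).indicator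
      (fun e : ℤ × ℤ => cubicGraph.b e.1 e.2) e ≤ 5 * (N : ℝ) ^ 3 := by
    intro e he
    refine (Set.indicator_le_self' (fun e _ => cubicGraph.nonneg e.1 e.2) e).trans ?_
    have hN1 := cubicCoeff_le hN (k := N) (by omega) (by omega)
    have hN2 := cubicCoeff_le hN (k := 2 * N) (by omega) le_rfl
    simp only [hT, Finset.mem_insert, Finset.mem_singleton] at he
    rcases he with rfl | rfl | rfl | rfl <;> rw [cubicGraph_b] <;>
      simp only [cubicWeight_succ, cubicWeight_succ_rev] <;> linarith
  refine (Finset.sum_le_card_nsmul T _ _ hterm).trans ?_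
  have hcard : (T.card : ℝ) ≤ 4 := by exact_mod_cast Finset.card_le_four
  rw [nsmul_eq_mul]
  nlinarith [pow_nonneg (Nat.cast_nonneg N : (0 : ℝ) ≤ N) 3]

lemma cubic_volume_ge (N : ℕ) :
    (N : ℝ) * ((N : ℝ) ^ 3 / 2)
      ≤ ∑ x ∈ Finset.Icc ((N : ℤ) + 1) (2 * N), cubicGraph.outWeight x := by
  have hcard : (Finset.Icc ((N : ℤ) + 1) (2 * N)).card = N := by
    rw [Int.card_Icc]
    omega
  have h := Finset.card_nsmul_le_sum (Finset.Icc ((N : ℤ) + 1) (2 * N))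
    (fun x => cubicGraph.outWeight x) ((N : ℝ) ^ 3 / 2) fun x hx => by
      have hx1 : (N : ℝ) ≤ x := by
        exact_mod_cast (by have := (Finset.mem_Icc.1 hx).1; omega : (N : ℤ) ≤ x)
      have h2 : (N : ℝ) ^ 3 ≤ |(x : ℝ)| ^ 3 :=
        pow_le_pow_left₀ N.cast_nonneg (hx1.trans (le_abs_self _)) 3
      rw [cubic_outWeight]
      have := cubicCoeff_pos (x - 1)
      rw [cubicCoeff]
      linarith
  rwa [hcard, nsmul_eq_mul] at h

lemma cubic_outWeight_nonneg (x : ℤ) : 0 ≤ cubicGraph.outWeight x :=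
  tsum_nonneg fun y => cubicGraph.nonneg x y

lemma cubic_cheeger_ratio_nonneg {r : ℝ} {Ω : Set ℤ}
    (hr : ∃ U : Finset ℤ, U.Nonempty ∧ (U : Set ℤ) ⊆ Ω ∧
      r = (∑' e : cubicGraph.edgeBoundary U, cubicGraph.b e.1.1 e.1.2)
        / ∑ x ∈ U, cubicGraph.outWeight x) : 0 ≤ r := by
  obtain ⟨U, -, -, rfl⟩ := hr
  exact div_nonneg (tsum_nonneg fun e => cubicGraph.nonneg _ _)
    (Finset.sum_nonneg fun x _ => cubic_outWeight_nonneg x)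

lemma cubic_cheegerTilde_le (n : ℕ) :
    cubicGraph.cheegerTilde (ballZ n)ᶜ ≤ 40 * (1 / ((n : ℝ) + 1)) := by
  -- This keeps [N+1, 2N] nonempty and outside V_n; the ratio is then at most 20N³/(N⁴/2) = 40/N.
  set N := n + 1 with hN
  have hNpos : (0 : ℝ) < N := by rw [hN]; positivity
  refine (csInf_le ⟨0, fun r hr => cubic_cheeger_ratio_nonneg hr⟩
    ⟨Finset.Icc ((N : ℤ) + 1) (2 * N), ?_, ?_, rfl⟩).trans ?_
  · exact Finset.nonempty_Icc.2 (by omega)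
  · intro x hx hx'
    have h1 := (Finset.mem_Icc.1 hx).1
    have h2 := hx'.2
    omega
  · refine (div_le_div₀ (by positivity) (cubic_edgeBoundary_le (by omega)) (by positivity)
      (cubic_volume_ge N)).trans (le_of_eq ?_)
    rw [show (n : ℝ) + 1 = N by rw [hN]; push_cast; rfl]
    field_simp
    norm_num

lemma cubic_tendsto_cheegerTilde :
    Tendsto (fun n : ℕ => cubicGraph.cheegerTilde (ballZ n)ᶜ) atTop (𝓝 0) := by
  have h := (tendsto_one_div_add_atTop_nhds_zero_nat (𝕜 := ℝ)).const_mul 40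
  rw [mul_zero] at h
  exact squeeze_zero (fun n => Real.sInf_nonneg fun r hr => cubic_cheeger_ratio_nonneg hr)
    cubic_cheegerTilde_le h

end Cheeger

end

theorem mainTheorem5 :
    -- the standing assumptions hold
    (cubicGraph.AssumptionBeta ∧ cubicGraph.AssumptionGamma ∧
      cubicGraph.Delta.IsClosable ∧ EssentiallySelfAdjoint cubicGraph.H ∧
      cubicGraph.S = cubicGraph.H.closure ∧
      cubicGraph.S.domain = cubicGraph.Delta.closure.domain) ∧
    -- the Cheeger constant at infinity vanishes
    Tendsto (fun n : ℕ => cubicGraph.cheegerTilde (ballZ n)ᶜ) atTop (𝓝 0) ∧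
    -- the Hardy inequality
    (∀ f : ℤ → ℂ, (Function.support f).Finite →
      (1 / 4 : ℝ) * ∑' k : ℤ, ‖f k‖ ^ 2 ≤ ∑' k : ℤ, (k : ℝ) ^ 2 * ‖f (k - 1) - f k‖ ^ 2) ∧
    -- the bottom of the spectrum of the Dirichlet operators
    (∀ n : ℕ, EssentiallySelfAdjoint (cubicGraph.HDirichlet (ballZ n)ᶜ) ∧
      lambdaOne (cubicGraph.SDirichlet (ballZ n)ᶜ)
        = rayleighInf (cubicGraph.HDirichlet (ballZ n)ᶜ) ∧
      (n : ℝ) / 8 ≤ lambdaOne (cubicGraph.SDirichlet (ballZ n)ᶜ)) ∧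
    Tendsto (fun n : ℕ => lambdaOne (cubicGraph.SDirichlet (ballZ n)ᶜ)) atTop atTop ∧
    -- the absence of essential spectrum
    essSpectrum cubicGraph.S = ∅ ∧
    essSpectrum cubicGraph.Delta.closure = ∅ := by
  obtain ⟨hcl, hdom, -⟩ := cubic_closure_Delta
  exact ⟨⟨cubic_assumptionBeta, cubic_assumptionGamma, hcl, cubic_H_essentiallySelfAdjoint,
      cubic_S_eq, by rw [cubic_S_eq, hdom]⟩,
    cubic_tendsto_cheegerTilde, hardy_inequality,
    fun n => ⟨cubic_HDirichlet_essentiallySelfAdjoint _, cubic_lambdaOne_eq n,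
      cubic_lambdaOne_ge n⟩,
    tendsto_atTop_mono cubic_lambdaOne_ge
      (tendsto_natCast_atTop_atTop.atTop_div_const (by norm_num)),
    cubic_essSpectrum_S, cubic_essSpectrum_Delta⟩
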